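/- **Setting.** Let $d\in\mathbb N$, let $Y_1,\dots,Y_d$ be a basis of $\mathbb R^d$ generating the lattice $\mathcal R$, and let $\mathcal V\subset\mathbb R^d$ be a unit-cell, i.e. a set whose translates by $\mathcal R$ tile $\mathbb R^d$ up to null sets. Write $\langle f\rangle=\frac1{|\mathcal V|}\int_{\mathcal V}f\,dx$ and $s:e=\sum_{i,j}s_{ij}e_{ij}$. Fourth-order tensors with minor symmetries are regarded as linear maps of symmetric second-order tensors, and inverses are taken in this sense. Let $L_0$ be a constant fourth-order tensor with major and minor symmetries that is positive definite on symmetric tensors. Let $L(x)$ be a measurable, $\mathcal R$-periodic field of fourth-order tensors with major and minor symmetries that is essentially bounded and uniformly positive definite (for some $\alpha>0$, $L(x)e:e\ge\alpha\,e:e$ for a.e. $x$ and all symmetric $e$). Let $\bar\varepsilon$ be a constant symmetric second-order tensor. Let $H_e$ and $H_s$ both denote the space of $\mathcal R$-periodic, locally square integrable fields of symmetric second-order tensors on $\mathbb R^d$ (modulo a.e. equality), equipped respectively with the scalar products $$(\eta,\tilde\eta)_{H_e}=\langle L_0\eta:\tilde\eta\rangle,\qquad (\tau,\tilde\tau)_{H_s}=\langle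 \tau:L_0^{-1}\tilde\tau\rangle .$$ Let $E_0\subset H_e$ be the set of fields $\frac12(\nabla w+\nabla w^{\top})$ with $w\in H^1_{\rm per}(\mathcal V)^d$. Let $S=U_s\oplus S_0\subset H_s$, where $U_s$ is the set of constant fields and $S_0$ is the set of $s\in H_s$ with $\langle s\rangle=0$ and $\operatorname{div}s=0$, $s\cdot n$ anti-periodic on $\partial\mathcal V$ (in the weak sense: $\sum_j\int_{\mathcal V}s_{ij}\,\partial_j\varphi\,dx=0$ for all $i$ and all smooth $\mathcal R$-periodic $\varphi$). Let $P_{E_0}$ be the orthogonal projector of $H_e$ onto $E_0$, and $P_{S^\perp}$ the orthogonal projector of $H_s$ onto the orthogonal complement $S^\perp$ of $S$ in $H_s$. For $(\tau,\eta)\in H_s\times H_e$ let $$\mathcal P(\tau,\eta)=\Delta_{\rm Compat}(\eta)+\Delta_{\rm Const}(\tau,\eta)+\Delta_{\rm Equil}(\tau),$$ $$\Delta_{\rm Compat}(\eta)=\tfrac12\|(I-P_{E_0})\eta-\bar\varepsilon\|_{H_e}^2,\quad \Delta_{\rm Const}(\tau,\eta)=\big\langle \tfrac12L\eta:\eta+\tfrac12\tau:L^{-1}\tau-\tau:\eta\big\rangle,\quad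 \Delta_{\rm Equil}(\tau)=\tfrac12\|P_{S^\perp}\tau\|_{H_s}^2 .$$ The partial gradient $\nabla_\tau\mathcal P(\tau,\eta)$ is the element $g$ of $H_s$ such that $(g,\tilde\tau)_{H_s}=\lim_{t\to0}\frac{\mathcal P(\tau+t\tilde\tau,\eta)-\mathcal P(\tau,\eta)}t$ for all $\tilde\tau\in H_s$ (the limits being required to exist); $\nabla_\eta\mathcal P(\tau,\eta)\in H_e$ is defined in the same way with $(\cdot,\cdot)_{H_e}$ and variations of $\eta$. **Proposition.** The two orthogonal projectors are well defined: every $\eta\in H_e$ has an orthogonal projection onto $E_0$ and every $\tau\in H_s$ has an orthogonal projection onto $S^\perp$. For all $(\tau,\eta)\in H_s\times H_e$ both partial gradients of $\mathcal P$ exist, are unique, and are given by $$\nabla_\tau\mathcal P(\tau,\eta)=L_0\big(L^{-1}\tau-\eta\big)+P_{S^\perp}\tau,\qquad \nabla_\eta\mathcal P(\tau,\eta)=L_0^{-1}\big(L\eta-\tau\big)+(I-P_{E_0})\eta-\bar\varepsilon .$$ -/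

import Mathlib

open MeasureTheory
open scoped ContDiff

namespace Homogenization

noncomputable section

/-- Points of `ℝ^d`. -/
abbrev Pt (d : ℕ) := EuclideanSpace ℝ (Fin d)

/-- Second-order tensors on `ℝ^d` with components `e (i, j)`. The inner product of this Euclidean
space is the doubly contracted product `s : e = ∑ i j, s (i, j) * e (i, j)`. -/
abbrev Tens2 (d : ℕ) := EuclideanSpace ℝ (Fin d × Fin d)

/-- Symmetric second-order tensors, with the doubly contracted product as inner product. -/
def SymT (d : ℕ) : Submodule ℝ (Tens2 d) where
  carrier := {e | ∀ i j, e (i, j) = e (j, i)}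
  add_mem' := fun {a b} ha hb i j => by simp [ha i j, hb i j]
  zero_mem' := fun i j => by simp
  smul_mem' := fun c a ha i j => by simp [ha i j]

/-- The inner product of `SymT d` is the doubly contracted product. -/
lemma inner_symT {d : ℕ} (s e : SymT d) :
    inner ℝ s e = ∑ i, ∑ j, (s : Tens2 d) (i, j) * (e : Tens2 d) (i, j) := by
  rw [Submodule.coe_inner, PiLp.inner_apply, Fintype.sum_prod_type]
  simp [mul_comm]

/-- Fourth-order tensors with minor symmetries are the linear maps from symmetric tensors to
symmetric tensors. The inverse `A⁻¹` of such a tensor is `A.inverse`. -/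
abbrev Tens4 (d : ℕ) := SymT d →L[ℝ] SymT d

/-- Uniform elastic stiffness tensors: major symmetry and positive definiteness (the minor
symmetries are in the type). -/
structure IsElasticTensor {d : ℕ} (A : Tens4 d) : Prop where
  symm : ∀ e e' : SymT d, inner ℝ (A e) e' = inner ℝ e (A e')
  pos : ∀ e : SymT d, e ≠ 0 → 0 < inner ℝ (A e) e

/-- A unit-cell `V ⊂ ℝ^d`: its translates by the lattice generated by the `d` independent vectors
`Y 0, …, Y (d-1)` tile the space up to null sets. -/
structure UnitCell (d : ℕ) where
  /-- the generators of the lattice -/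
  Y : Module.Basis (Fin d) ℝ (Pt d)
  /-- the cell -/
  V : Set (Pt d)
  tiles : IsAddFundamentalDomain (Submodule.span ℤ (Set.range Y)) V (volume : Measure (Pt d))

variable {d : ℕ}

/-- The lattice of periods. -/
def UnitCell.lattice (C : UnitCell d) : Submodule ℤ (Pt d) := Submodule.span ℤ (Set.range C.Y)

/-- The average `⟨f⟩` of a function over the unit-cell. -/
def UnitCell.avg (C : UnitCell d) (f : Pt d → ℝ) : ℝ := ⨍ x in C.V, f x ∂volume

/-- `L²_per` with values in `F`: classes, modulo a.e. equality, of functions on `ℝ^d` that are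
locally square integrable and invariant under the lattice. -/
def L2per (C : UnitCell d) (F : Type*) [NormedAddCommGroup F] [NormedSpace ℝ F] :
    Submodule ℝ (Pt d →ₘ[volume] F) where
  carrier := {f | (∀ K : Set (Pt d), IsCompact K → MemLp f 2 (volume.restrict K)) ∧
    ∀ v ∈ C.lattice, ∀ᵐ x : Pt d, f (x + v) = f x}
  add_mem' := by
    rintro f g ⟨hf, hf'⟩ ⟨hg, hg'⟩
    have h := AEEqFun.coeFn_add f g
    refine ⟨fun K hK => ((hf K hK).add (hg K hK)).ae_eq (ae_restrict_of_ae h.symm), fun v hv => ?_⟩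
    filter_upwards [hf' v hv, hg' v hv, h,
      (measurePreserving_add_right volume v).quasiMeasurePreserving.ae h] with x h1 h2 h3 h4
    rw [h3, h4]
    simp [h1, h2]
  zero_mem' := by
    have h := AEEqFun.coeFn_zero (α := Pt d) (μ := volume) (β := F)
    refine ⟨fun K hK => MemLp.zero.ae_eq (ae_restrict_of_ae h.symm), fun v hv => ?_⟩
    filter_upwards [h,
      (measurePreserving_add_right volume v).quasiMeasurePreserving.ae h] with x h3 h4
    rw [h3, h4]
    simp
  smul_mem' := by
    rintro c f ⟨hf, hf'⟩
    have h := AEEqFun.coeFn_smul c f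
    refine ⟨fun K hK => ((hf K hK).const_smul c).ae_eq (ae_restrict_of_ae h.symm), fun v hv => ?_⟩
    filter_upwards [hf' v hv, h,
      (measurePreserving_add_right volume v).quasiMeasurePreserving.ae h] with x h1 h3 h4
    rw [h3, h4]
    simp [h1]

instance {C : UnitCell d} {F : Type*} [NormedAddCommGroup F] [NormedSpace ℝ F] :
    CoeFun (L2per C F) (fun _ => Pt d → F) := ⟨fun f => ((f : Pt d →ₘ[volume] F) : Pt d → F)⟩

/-- The underlying vector space of strain fields `H_e`: symmetric `L²_per` tensor fields. -/
abbrev StrainField (C : UnitCell d) := L2per C (SymT d)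

/-- The underlying vector space of stress fields `H_s`: symmetric `L²_per` tensor fields. -/
abbrev StressField (C : UnitCell d) := L2per C (SymT d)

/-- The uniform field equal to `e`. -/
def uniform (C : UnitCell d) (e : SymT d) : L2per C (SymT d) :=
  ⟨AEEqFun.const (Pt d) e, by
    have h := AEEqFun.coeFn_const (α := Pt d) (μ := volume) e
    refine ⟨fun K hK => ?_, fun v hv => ?_⟩
    · have : IsFiniteMeasure (volume.restrict K) := ⟨by simpa using hK.measure_lt_top⟩
      exact (memLp_const e).ae_eq (ae_restrict_of_ae h.symm)
    · filter_upwards [h,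
        (measurePreserving_add_right volume v).quasiMeasurePreserving.ae h] with x h3 h4
      rw [h3, h4]
      simp⟩

/-- Periodic, essentially bounded fields of fourth-order tensors with minor symmetries. -/
structure BddField (C : UnitCell d) where
  /-- the tensor at a point -/
  toFun : Pt d → Tens4 d
  aesm : AEStronglyMeasurable toFun volume
  periodic : ∀ v ∈ C.lattice, ∀ᵐ x : Pt d, toFun (x + v) = toFun x
  bdd : ∃ M : ℝ, ∀ᵐ x : Pt d, ‖toFun x‖ ≤ M

/-- A uniform tensor, as a field. -/
def BddField.const (C : UnitCell d) (A : Tens4 d) : BddField C where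
  toFun := fun _ => A
  aesm := aestronglyMeasurable_const
  periodic := fun _ _ => by simp
  bdd := ⟨‖A‖, by simp⟩

lemma BddField.aestronglyMeasurable_apply {C : UnitCell d} (A : BddField C)
    (η : L2per C (SymT d)) : AEStronglyMeasurable (fun x => A.toFun x (η x)) volume := by
  have h : Continuous fun p : Tens4 d × SymT d => p.1 p.2 := isBoundedBilinearMap_apply.continuous
  exact h.comp_aestronglyMeasurable
    (A.aesm.prodMk (η : Pt d →ₘ[volume] SymT d).aestronglyMeasurable)

/-- The local operator `η ↦ (x ↦ A(x) η(x))` on `L²_per`. -/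
def BddField.act {C : UnitCell d} (A : BddField C) (η : L2per C (SymT d)) : L2per C (SymT d) :=
  ⟨AEEqFun.mk (fun x => A.toFun x (η x)) (A.aestronglyMeasurable_apply η), by
    have h := AEEqFun.coeFn_mk _ (A.aestronglyMeasurable_apply η)
    obtain ⟨M, hM⟩ := A.bdd
    refine ⟨fun K hK => ?_, fun v hv => ?_⟩
    · refine MemLp.ae_eq (ae_restrict_of_ae h.symm) ((η.2.1 K hK).of_le_mul (c := M)
        (A.aestronglyMeasurable_apply η).restrict (ae_restrict_of_ae ?_))
      filter_upwards [hM] with x hx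
      exact ((A.toFun x).le_opNorm _).trans (by gcongr)
    · filter_upwards [h, (measurePreserving_add_right volume v).quasiMeasurePreserving.ae h,
        A.periodic v hv, η.2.2 v hv] with x h1 h2 h3 h4
      rw [h1, h2, h3, h4]⟩

/-- The stiffness field `L(x)` of a periodic linear elastic composite: essentially bounded, with
major and minor symmetries, and uniformly positive definite. -/
structure ElasticField (C : UnitCell d) extends BddField C where
  symm : ∀ᵐ x : Pt d, ∀ e e' : SymT d, inner ℝ (toFun x e) e' = inner ℝ e (toFun x e')
  coercive : ∃ α : ℝ, 0 < α ∧ ∀ᵐ x : Pt d, ∀ e : SymT d, α * ‖e‖ ^ 2 ≤ inner ℝ (toFun x e) e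

lemma norm_le_of_coercive {A : Tens4 d} {α : ℝ}
    (h : ∀ e : SymT d, α * ‖e‖ ^ 2 ≤ inner ℝ (A e) e) (e : SymT d) : α * ‖e‖ ≤ ‖A e‖ := by
  rcases eq_or_lt_of_le (norm_nonneg e) with h0 | h0
  · rw [← h0]; simp
  · have h1 := (h e).trans (real_inner_le_norm _ _)
    nlinarith

lemma inverse_of_coercive {A : Tens4 d} {α : ℝ} (hα : 0 < α)
    (h : ∀ e : SymT d, α * ‖e‖ ^ 2 ≤ inner ℝ (A e) e) :
    (∀ s, A (A.inverse s) = s) ∧ (∀ e, A.inverse (A e) = e) ∧ ‖A.inverse‖ ≤ α⁻¹ := by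
  have hi : Function.Injective A := by
    rw [injective_iff_map_eq_zero]
    intro e he
    have := norm_le_of_coercive h e
    rw [he, norm_zero] at this
    have h2 := norm_nonneg e
    exact norm_eq_zero.1 (by nlinarith)
  let B := (LinearEquiv.ofInjectiveEndo (A : SymT d →ₗ[ℝ] SymT d) hi).toContinuousLinearEquiv
  have hB : (B : Tens4 d) = A := by ext1 x; rfl
  have hinv : A.inverse = (B.symm : Tens4 d) := by
    rw [← hB, ContinuousLinearMap.inverse_equiv]
  have h1 : ∀ s, A (A.inverse s) = s := fun s => by
    rw [hinv]; exact B.apply_symm_apply s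
  refine ⟨h1, fun e => by rw [hinv]; exact B.symm_apply_apply e, ?_⟩
  refine ContinuousLinearMap.opNorm_le_bound _ (by positivity) fun s => ?_
  have := norm_le_of_coercive h (A.inverse s)
  rw [h1 s] at this
  rwa [inv_mul_eq_div, le_div_iff₀' hα]

lemma measurable_inverse (d : ℕ) :
    Measurable (fun A : Tens4 d => A.inverse) := by
  classical
  have h : (fun A : Tens4 d => A.inverse) =
      Set.piecewise {A : Tens4 d | IsUnit A} Ring.inverse (fun _ => 0) := by
    funext A
    by_cases hA : IsUnit A
    · simp [Set.piecewise, hA, ContinuousLinearMap.ringInverse_eq_inverse]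
    · simp [Set.piecewise, hA, ← ContinuousLinearMap.ringInverse_eq_inverse, Ring.inverse_non_unit]
  rw [h]
  have ho : IsOpen {A : Tens4 d | IsUnit A} := Units.isOpen (R := Tens4 d)
  refine ContinuousOn.measurable_piecewise ?_ continuousOn_const ho.measurableSet
  rintro _ ⟨u, rfl⟩
  exact (NormedRing.inverse_continuousAt (R := Tens4 d) u).continuousWithinAt

/-- The compliance field `L⁻¹(x)`. -/
def ElasticField.inv {C : UnitCell d} (L : ElasticField C) : BddField C where
  toFun := fun x => (L.toFun x).inverse
  aesm := by
    have : SecondCountableTopology (Tens4 d) :=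
      have := FiniteDimensional.proper ℝ (Tens4 d); inferInstance
    exact ((measurable_inverse d).comp_aemeasurable L.aesm.aemeasurable).aestronglyMeasurable
  periodic := fun v hv => by
    filter_upwards [L.periodic v hv] with x hx
    rw [hx]
  bdd := by
    obtain ⟨α, hα, h⟩ := L.coercive
    refine ⟨α⁻¹, ?_⟩
    filter_upwards [h] with x hx
    exact (inverse_of_coercive hα hx).2.2

/-- The energetic scalar product `⟨L₀ η : η'⟩` on `H_e`. -/
def scalarE (C : UnitCell d) (L₀ : Tens4 d) (η η' : StrainField C) : ℝ :=
  C.avg fun x => inner ℝ (L₀ (η x)) (η' x)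

/-- The energetic scalar product `⟨τ : L₀⁻¹ τ'⟩` on `H_s`. -/
def scalarS (C : UnitCell d) (L₀ : Tens4 d) (τ τ' : StressField C) : ℝ :=
  C.avg fun x => inner ℝ (τ x) (L₀.inverse (τ' x))

/-- Smooth functions that are periodic with respect to the lattice. -/
def IsPeriodicTest (C : UnitCell d) (φ : Pt d → ℝ) : Prop :=
  ContDiff ℝ ∞ φ ∧ ∀ v ∈ C.lattice, ∀ x, φ (x + v) = φ x

/-- The partial derivative `∂_j φ`. -/
def partialDeriv (j : Fin d) (φ : Pt d → ℝ) (x : Pt d) : ℝ :=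
  fderiv ℝ φ x (EuclideanSpace.single j 1)

/-- `∂_j f = g` in the sense of periodic distributions. A function `f` in `L²_per` belongs to
`H¹_per` if and only if it has such a weak derivative `g` in `L²_per` for every `j`. -/
def IsWeakPartial (C : UnitCell d) (j : Fin d) (f g : L2per C ℝ) : Prop :=
  ∀ φ : Pt d → ℝ, IsPeriodicTest C φ →
    ∫ x in C.V, f x * partialDeriv j φ x = - ∫ x in C.V, g x * φ x

/-- Compatible strain fields `E₀`: symmetric gradients of displacements `w` in `H¹_per`; here
`G i j` is the weak derivative `∂_j w_i`. -/
def compatibleStrains (C : UnitCell d) : Set (StrainField C) :=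
  {e | ∃ (w : Fin d → L2per C ℝ) (G : Fin d → Fin d → L2per C ℝ),
    (∀ i j, IsWeakPartial C j (w i) (G i j)) ∧
    ∀ᵐ x : Pt d, ∀ i j, (e x : Tens2 d) (i, j) = 1 / 2 * (G i j x + G j i x)}

/-- Uniform stress fields `U_s`. -/
def uniformStresses (C : UnitCell d) : Set (StressField C) := Set.range (uniform C)

/-- Self-equilibrated stress fields `S₀`: mean-free, with `div s = 0` and anti-periodic tractions
`s · n` on the boundary of the cell. The last two conditions are expressed weakly against periodic
test functions, i.e. `div s = 0` in the sense of periodic distributions. -/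
def selfEquilibratedStresses (C : UnitCell d) : Set (StressField C) :=
  {s | (∀ i : Fin d, ∀ φ : Pt d → ℝ, IsPeriodicTest C φ →
      ∑ j, ∫ x in C.V, (s x : Tens2 d) (i, j) * partialDeriv j φ x = 0) ∧
    ∀ i j, C.avg (fun x => (s x : Tens2 d) (i, j)) = 0}

/-- Admissible stress fields `S = U_s ⊕ S₀`. -/
def admissibleStresses (C : UnitCell d) : Set (StressField C) :=
  {s | ∃ u ∈ uniformStresses C, ∃ s₀ ∈ selfEquilibratedStresses C, s = u + s₀}

/-- The orthogonal of `K` for the scalar product `ps`. -/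
def orthogonalFor {H : Type*} (ps : H → H → ℝ) (K : Set H) : Set H :=
  {h | ∀ k ∈ K, ps h k = 0}

/-- `p` is the orthogonal projection of `h` onto the linear subspace `K` for the scalar product
`ps`. -/
def IsOrthProj {H : Type*} [AddCommGroup H] (ps : H → H → ℝ) (K : Set H) (h p : H) : Prop :=
  p ∈ K ∧ ∀ k ∈ K, ps (h - p) k = 0

open Classical in
/-- The orthogonal projector onto `K` for the scalar product `ps` (the value `0` is used only
where no orthogonal projection exists). -/
def orthProj {H : Type*} [AddCommGroup H] (ps : H → H → ℝ) (K : Set H) (h : H) : H :=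
  if hp : ∃ p, IsOrthProj ps K h p then hp.choose else 0

/-- The orthogonal projector `P_{E₀}` of `H_e`. -/
def projE₀ (C : UnitCell d) (L₀ : Tens4 d) : StrainField C → StrainField C :=
  orthProj (scalarE C L₀) (compatibleStrains C)

/-- The subspace `S^⊥` of `H_s`. -/
def stressesPerp (C : UnitCell d) (L₀ : Tens4 d) : Set (StressField C) :=
  orthogonalFor (scalarS C L₀) (admissibleStresses C)

/-- The orthogonal projector `P_{S^⊥}` of `H_s`. -/
def projSperp (C : UnitCell d) (L₀ : Tens4 d) : StressField C → StressField C :=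
  orthProj (scalarS C L₀) (stressesPerp C L₀)

/-- The norm of `H_e`. -/
def normE (C : UnitCell d) (L₀ : Tens4 d) (η : StrainField C) : ℝ := √(scalarE C L₀ η η)

/-- The norm of `H_s`. -/
def normS (C : UnitCell d) (L₀ : Tens4 d) (τ : StressField C) : ℝ := √(scalarS C L₀ τ τ)

/-- The local error in constitutive relation
`r(x, τ, η) = ½ L η : η + ½ τ : L⁻¹ τ - τ : η`. -/
def constitutiveError {C : UnitCell d} (L : ElasticField C) (τ : StressField C)
    (η : StrainField C) (x : Pt d) : ℝ :=
  1 / 2 * inner ℝ (L.toFun x (η x)) (η x) + 1 / 2 * inner ℝ (τ x) ((L.toFun x).inverse (τ x))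
    - inner ℝ (τ x) (η x)

/-- `Δ_Compat(η) = ½ ‖(I - P_{E₀}) η - ε̄‖²` in `H_e`. -/
def deltaCompat (C : UnitCell d) (L₀ : Tens4 d) (εbar : SymT d) (η : StrainField C) : ℝ :=
  1 / 2 * normE C L₀ ((η - projE₀ C L₀ η) - uniform C εbar) ^ 2

/-- `Δ_Const(τ, η) = ⟨r(x, τ, η)⟩`. -/
def deltaConst {C : UnitCell d} (L : ElasticField C) (τ : StressField C) (η : StrainField C) : ℝ :=
  C.avg (constitutiveError L τ η)

/-- `Δ_Equil(τ) = ½ ‖P_{S^⊥} τ‖²` in `H_s`. -/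
def deltaEquil (C : UnitCell d) (L₀ : Tens4 d) (τ : StressField C) : ℝ :=
  1 / 2 * normS C L₀ (projSperp C L₀ τ) ^ 2

/-- The two-field functional `P(τ, η)`. -/
def functionalP {C : UnitCell d} (L₀ : Tens4 d) (L : ElasticField C) (εbar : SymT d)
    (τ : StressField C) (η : StrainField C) : ℝ :=
  deltaCompat C L₀ εbar η + deltaConst L τ η + deltaEquil C L₀ τ

/-- `g` is a gradient of `J` at `h` for the scalar product `ps`: for every direction `k`, the
derivative of `J` at `h` in the direction `k` exists and equals `ps g k`. -/
def IsGradientFor {H : Type*} [AddCommGroup H] [Module ℝ H] (ps : H → H → ℝ) (J : H → ℝ)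
    (h g : H) : Prop :=
  ∀ k : H, Filter.Tendsto (fun t : ℝ => (J (h + t • k) - J h) / t) (nhdsWithin 0 {0}ᶜ)
    (nhds (ps g k))

end

end Homogenization

open Homogenization

open scoped Pointwise

/-! ### The quotient torus and averages over the cell. -/

namespace Homogenization

noncomputable section

/-! In each variable separately the functional is a polynomial of degree two, so both gradients are
read off exact expansions in `t` (`functionalP_add_smul_left`, `functionalP_add_smul_right`);
definiteness of the energetic products gives uniqueness (`isGradientFor_iff`). The linear terms rest
on three facts: the projectors are linear and self-adjoint for the energetic products, `L` and its
inverse are symmetric almost everywhere, and uniform fields are orthogonal to compatible strains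
(`energyForm_uniform`), so that the derivative of the compatibility term is not altered by the mean
strain. The local term produces a plain L² pairing; rewriting it as an energetic one creates the
factors `L₀` and `L₀⁻¹`.

The analytic content is the existence of the projections. An orthogonal complement is always closed,
so S^⊥ costs nothing. For E₀, periodic fields are transported to the torus ℝ^d/lattice, where
Fourier series are available. A field is compatible if and only if each of its Fourier coefficients
is the symmetric part of `I a ⊗ ξ`, with ξ the wave vector and `a` some complex amplitude. Each of
these conditions is closed, being membership in a finite-dimensional subspace. Sufficiency needs a
displacement in H¹: Korn's inequality mode by mode controls its gradient, and the gap between zero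
and the nonzero wave vectors controls the displacement itself. Projections onto closed subspaces
then come from Lax–Milgram (`exists_mem_forall_inner_map_sub_eq_zero`). -/

/-- The Haar probability measure on the `d`-dimensional torus. -/
def torusMeasure (d : ℕ) : Measure (UnitAddTorus (Fin d)) :=
  Measure.pi fun _ => AddCircle.haarAddCircle

instance (d : ℕ) : IsProbabilityMeasure (torusMeasure d) := by
  unfold torusMeasure; infer_instance

instance (d : ℕ) : (torusMeasure d).IsAddHaarMeasure := by
  unfold torusMeasure; infer_instance

variable {d : ℕ} (C : UnitCell d)

/-- The quotient map of `ℝ^d` by the lattice, in the coordinates given by the generators. -/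
def UnitCell.toTorus : Pt d →+ UnitAddTorus (Fin d) where
  toFun x i := ((C.Y.repr x i : ℝ) : UnitAddCircle)
  map_zero' := by ext i; simp
  map_add' x y := by ext i; simp

lemma UnitCell.toTorus_apply (x : Pt d) (i : Fin d) :
    C.toTorus x i = ((C.Y.repr x i : ℝ) : UnitAddCircle) := rfl

lemma UnitCell.continuous_repr (i : Fin d) : Continuous fun x : Pt d => C.Y.repr x i :=
  (LinearMap.continuous_of_finiteDimensional (C.Y.coord i) :)

lemma UnitCell.continuous_toTorus : Continuous C.toTorus :=
  continuous_pi fun i => (AddCircle.continuous_mk' 1).comp (C.continuous_repr i)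

lemma UnitCell.measurable_toTorus : Measurable C.toTorus := C.continuous_toTorus.measurable

lemma UnitCell.toTorus_eq_zero_iff {x : Pt d} : C.toTorus x = 0 ↔ x ∈ C.lattice := by
  rw [UnitCell.lattice, C.Y.mem_span_iff_repr_mem ℤ, funext_iff]
  refine forall_congr' fun i => ?_
  rw [C.toTorus_apply, Pi.zero_apply, AddCircle.coe_eq_zero_iff]
  simp [Set.mem_range]

lemma UnitCell.toTorus_add_lattice (x : Pt d) {v : Pt d} (hv : v ∈ C.lattice) :
    C.toTorus (x + v) = C.toTorus x := by
  rw [map_add, C.toTorus_eq_zero_iff.2 hv, add_zero]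

/-- A section of the quotient map, with values in the parallelepiped of the generators. -/
def UnitCell.lift (θ : UnitAddTorus (Fin d)) : Pt d :=
  ∑ i, (AddCircle.equivIco 1 0 (θ i) : ℝ) • C.Y i

lemma UnitCell.toTorus_lift (θ : UnitAddTorus (Fin d)) : C.toTorus (C.lift θ) = θ := by
  ext i
  rw [C.toTorus_apply, UnitCell.lift, C.Y.repr_sum_self]
  exact AddCircle.coe_equivIco

lemma UnitCell.measurable_lift : Measurable C.lift := by
  refine Finset.measurable_sum _ fun i _ => Measurable.smul_const ?_ _
  exact measurable_subtype_coe.comp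
    ((AddCircle.measurableEquivIco 1 0).measurable.comp (measurable_pi_apply i))

lemma UnitCell.lift_toTorus_sub_mem (x : Pt d) : C.lift (C.toTorus x) - x ∈ C.lattice := by
  rw [← C.toTorus_eq_zero_iff, map_sub, C.toTorus_lift, sub_self]

lemma UnitCell.toTorus_surjective : Function.Surjective C.toTorus :=
  fun θ => ⟨_, C.toTorus_lift θ⟩

instance : Countable C.lattice := by
  unfold UnitCell.lattice; infer_instance

instance : VAddInvariantMeasure C.lattice (Pt d) volume :=
  inferInstanceAs <| VAddInvariantMeasure C.lattice.toAddSubgroup (Pt d) volume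

-- The image measure is translation invariant: translating on the torus amounts to replacing `D` by
-- `y +ᵥ D`, another fundamental domain, and a lattice-invariant set has the same measure in both.
-- Uniqueness of Haar measure leaves a constant, fixed by the total mass.
variable {C} in
lemma map_toTorus_restrict {D : Set (Pt d)}
    (hD : IsAddFundamentalDomain C.lattice D (volume : Measure (Pt d)))
    (hfin : volume D ≠ ⊤) :
    (volume.restrict D).map C.toTorus = volume D • torusMeasure d := by
  have : IsFiniteMeasure (volume.restrict D) := ⟨by simpa using hfin.lt_top⟩
  set μ' := (volume.restrict D).map C.toTorus with hμ'
  have hinv : μ'.IsAddLeftInvariant := by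
    refine ⟨fun g => ?_⟩
    obtain ⟨y, rfl⟩ := C.toTorus_surjective g
    ext s hs
    have hm : Measurable fun θ : UnitAddTorus (Fin d) => C.toTorus y + θ :=
      (continuous_const_add _).measurable
    have hA := C.measurable_toTorus hs
    rw [Measure.map_apply hm hs, hμ', Measure.map_apply C.measurable_toTorus (hm hs),
      Measure.map_apply C.measurable_toTorus hs, Measure.restrict_apply hA,
      Measure.restrict_apply (C.measurable_toTorus (hm hs))]
    have hyD : IsAddFundamentalDomain C.lattice (y +ᵥ D) (volume : Measure (Pt d)) :=
      hD.vadd_of_comm y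
    have h1 := hD.measure_set_eq hyD hA (fun g => by
      ext x
      simp only [Set.mem_preimage]
      rw [show (g +ᵥ x) = x + (g : Pt d) from add_comm _ _, C.toTorus_add_lattice _ g.2])
    rw [h1, ← measure_preimage_add volume y (C.toTorus ⁻¹' s ∩ (y +ᵥ D))]
    congr 1
    ext x
    simp [Set.mem_vadd_set]
  obtain ⟨c, hc⟩ : ∃ c : NNReal, μ' = c • torusMeasure d :=
    ⟨_, Measure.isAddInvariant_eq_smul_of_compactSpace μ' (torusMeasure d)⟩
  have h2 : μ' Set.univ = volume D := by
    simp [hμ', Measure.map_apply C.measurable_toTorus]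
  have h3 : volume D = c := by
    rw [← h2, hc, Measure.smul_apply, measure_univ, ENNReal.smul_def, smul_eq_mul, mul_one]
  rw [hc, h3]
  rfl

lemma UnitCell.isAddFundamentalDomain_parallelepiped :
    IsAddFundamentalDomain C.lattice (ZSpan.fundamentalDomain C.Y) (volume : Measure (Pt d)) :=
  ZSpan.isAddFundamentalDomain C.Y volume

lemma UnitCell.isAddFundamentalDomain :
    IsAddFundamentalDomain C.lattice C.V (volume : Measure (Pt d)) := C.tiles

lemma UnitCell.volume_parallelepiped_ne_top : volume (ZSpan.fundamentalDomain C.Y) ≠ ⊤ :=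
  (ZSpan.fundamentalDomain_isBounded C.Y).measure_lt_top.ne

/-- The cell is arbitrary and possibly unbounded; its finite nonzero volume is inherited from the
parallelepiped. -/
lemma UnitCell.volume_eq : volume C.V = volume (ZSpan.fundamentalDomain C.Y) :=
  C.isAddFundamentalDomain.measure_eq C.isAddFundamentalDomain_parallelepiped

lemma UnitCell.volume_ne_top : volume C.V ≠ ⊤ := C.volume_eq ▸ C.volume_parallelepiped_ne_top

lemma UnitCell.volume_ne_zero : volume C.V ≠ 0 :=
  C.volume_eq ▸ ZSpan.measure_fundamentalDomain_ne_zero C.Y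

lemma UnitCell.map_toTorus :
    (volume.restrict C.V).map C.toTorus = volume C.V • torusMeasure d :=
  map_toTorus_restrict C.isAddFundamentalDomain C.volume_ne_top

instance : IsFiniteMeasure ((volume : Measure (Pt d)).restrict C.V) :=
  ⟨by simpa using C.volume_ne_top.lt_top⟩

/-- A preimage under the quotient map is lattice invariant, hence null once its trace on the cell
is. This is what allows classes modulo a.e. equality to be pulled back. -/
lemma UnitCell.quasiMeasurePreserving_toTorus :
    Measure.QuasiMeasurePreserving C.toTorus volume (torusMeasure d) := by
  refine ⟨C.measurable_toTorus, Measure.AbsolutelyContinuous.mk fun s hs h0 => ?_⟩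
  rw [Measure.map_apply C.measurable_toTorus hs]
  refine C.isAddFundamentalDomain.measure_zero_of_invariant _ (fun g => ?_) ?_
  · ext x
    rw [Set.mem_vadd_set_iff_neg_vadd_mem, Set.mem_preimage, Set.mem_preimage,
      show (-g +ᵥ x) = x + ((-g : C.lattice) : Pt d) from add_comm _ _,
      C.toTorus_add_lattice _ (-g).2]
  · have h := congrArg (fun m => m s) C.map_toTorus
    simp only [Measure.smul_apply, h0, smul_zero] at h
    rwa [Measure.map_apply C.measurable_toTorus hs,
      Measure.restrict_apply (C.measurable_toTorus hs)] at h

/-- Averages over the cell are integrals over the torus. -/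
lemma setAverage_comp_toTorus {E : Type*} [NormedAddCommGroup E] [NormedSpace ℝ E]
    {h : UnitAddTorus (Fin d) → E} (hh : AEStronglyMeasurable h (torusMeasure d)) :
    ⨍ x in C.V, h (C.toTorus x) ∂volume = ∫ θ, h θ ∂torusMeasure d := by
  have hac : AEStronglyMeasurable h ((volume.restrict C.V).map C.toTorus) := by
    rw [C.map_toTorus]; exact hh.mono_ac (Measure.smul_absolutelyContinuous)
  rw [setAverage_eq, ← integral_map C.measurable_toTorus.aemeasurable hac, C.map_toTorus,
    integral_smul_measure, smul_smul, measureReal_def, inv_mul_cancel₀, one_smul]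
  exact ENNReal.toReal_ne_zero.2 ⟨C.volume_ne_zero, C.volume_ne_top⟩

end

end Homogenization

/-! ### Periodic fields as square integrable functions on the torus. -/

namespace Homogenization

noncomputable section

variable {d : ℕ} (C : UnitCell d) {F : Type*} [NormedAddCommGroup F] [NormedSpace ℝ F]

variable {C} in
lemma memLp_comp_toTorus_restrict {G : Type*} [NormedAddCommGroup G] {D : Set (Pt d)}
    (hD : IsAddFundamentalDomain C.lattice D (volume : Measure (Pt d))) (hfin : volume D ≠ ⊤)
    {g : UnitAddTorus (Fin d) → G} (hg : MemLp g 2 (torusMeasure d)) :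
    MemLp (g ∘ C.toTorus) 2 (volume.restrict D) := by
  refine (memLp_map_measure_iff ?_ C.measurable_toTorus.aemeasurable).1 ?_ <;>
    rw [map_toTorus_restrict hD hfin]
  · exact hg.1.mono_ac Measure.smul_absolutelyContinuous
  · exact hg.smul_measure hfin

/-- A compact set is covered by finitely many lattice translates of the bounded parallelepiped. -/
lemma memLp_comp_toTorus {G : Type*} [NormedAddCommGroup G] {g : UnitAddTorus (Fin d) → G}
    (hg : MemLp g 2 (torusMeasure d))
    {K : Set (Pt d)} (hK : IsCompact K) : MemLp (g ∘ C.toTorus) 2 (volume.restrict K) := by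
  have hfin : ((K - ZSpan.fundamentalDomain C.Y) ∩
      (Submodule.span ℤ (Set.range C.Y) : Set (Pt d))).Finite :=
    ZSpan.setFinite_inter C.Y (hK.isBounded.sub (ZSpan.fundamentalDomain_isBounded C.Y))
  have haesm : AEStronglyMeasurable (g ∘ C.toTorus) (volume : Measure (Pt d)) :=
    hg.1.comp_quasiMeasurePreserving C.quasiMeasurePreserving_toTorus
  rw [memLp_two_iff_integrable_sq_norm haesm.restrict]
  refine IntegrableOn.mono_set (t := ⋃ v ∈ (K - ZSpan.fundamentalDomain C.Y) ∩
      (Submodule.span ℤ (Set.range C.Y) : Set (Pt d)), (v +ᵥ ZSpan.fundamentalDomain C.Y))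
    ((integrableOn_finite_biUnion hfin).2 fun v hv => ?_) fun x hx => ?_
  · have h := memLp_comp_toTorus_restrict (C := C)
      (C.isAddFundamentalDomain_parallelepiped.vadd_of_comm v)
      (by rw [measure_vadd]; exact C.volume_parallelepiped_ne_top) hg
    exact (memLp_two_iff_integrable_sq_norm haesm.restrict).1 h
  · have h1 := ZSpan.fract_mem_fundamentalDomain C.Y x
    have h2 : ((ZSpan.floor C.Y x : Submodule.span ℤ (Set.range C.Y)) : Pt d)
        = x - ZSpan.fract C.Y x := by
      rw [ZSpan.fract_apply]; abel
    refine Set.mem_biUnion (x := ((ZSpan.floor C.Y x : Submodule.span ℤ (Set.range C.Y)) : Pt d))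
      ⟨?_, SetLike.coe_mem _⟩ ?_
    · rw [h2]
      exact Set.sub_mem_sub hx h1
    · rw [h2]
      refine ⟨_, h1, ?_⟩
      simp

/-- Pull-back to `ℝ^d` of a square integrable function on the torus. -/
def pull : Lp F 2 (torusMeasure d) →ₗ[ℝ] L2per C F where
  toFun g := ⟨(g : UnitAddTorus (Fin d) →ₘ[torusMeasure d] F).compQuasiMeasurePreserving
      C.toTorus C.quasiMeasurePreserving_toTorus, by
    have h := AEEqFun.coeFn_compQuasiMeasurePreserving
      (g : UnitAddTorus (Fin d) →ₘ[torusMeasure d] F) C.quasiMeasurePreserving_toTorus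
    refine ⟨fun K hK => (memLp_comp_toTorus C (Lp.memLp g) hK).ae_eq
      (ae_restrict_of_ae h.symm), fun v hv => ?_⟩
    filter_upwards [h, (measurePreserving_add_right volume v).quasiMeasurePreserving.ae h]
      with x h1 h2
    rw [h1, h2, Function.comp_apply, Function.comp_apply, C.toTorus_add_lattice x hv]⟩
  map_add' f g := by
    apply Subtype.ext
    obtain ⟨⟨f, hf⟩, hf'⟩ := f
    obtain ⟨⟨g, hg⟩, hg'⟩ := g
    rfl
  map_smul' c f := by
    apply Subtype.ext
    obtain ⟨⟨f, hf⟩, hf'⟩ := f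
    rfl

lemma coeFn_pull (g : Lp F 2 (torusMeasure d)) :
    (pull C g : Pt d → F) =ᵐ[volume] g ∘ C.toTorus :=
  AEEqFun.coeFn_compQuasiMeasurePreserving
      (g : UnitAddTorus (Fin d) →ₘ[torusMeasure d] F) C.quasiMeasurePreserving_toTorus

variable {C} in
lemma L2per_ext {f g : L2per C F} (h : (f : Pt d → F) =ᵐ[volume] g) : f = g :=
  Subtype.ext (AEEqFun.ext h)

-- The lattice is countable, so one null set serves all periods and the translation may depend on
-- the point.
variable {C} in
lemma comp_lift_toTorus (f : L2per C F) :
    (fun x => f (C.lift (C.toTorus x))) =ᵐ[volume] f := by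
  have h : ∀ᵐ x : Pt d, ∀ v : C.lattice, f (x + v) = f x :=
    ae_all_iff.2 fun v => f.2.2 v v.2
  filter_upwards [h] with x hx
  simpa using hx ⟨_, C.lift_toTorus_sub_mem x⟩

-- Square integrability is given on compact sets only, so the parallelepiped is used here: it is
-- bounded, whereas `C.V` need not be.
variable {C} in
lemma memLp_comp_lift (f : L2per C F) : MemLp (fun θ => f (C.lift θ)) 2 (torusMeasure d) := by
  have hsm : StronglyMeasurable fun θ => f (C.lift θ) :=
    (AEEqFun.stronglyMeasurable _).comp_measurable C.measurable_lift
  set D := ZSpan.fundamentalDomain C.Y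
  have h0 : volume D ≠ 0 := ZSpan.measure_fundamentalDomain_ne_zero C.Y
  have hfin := C.volume_parallelepiped_ne_top
  have h1 : MemLp (fun θ => f (C.lift θ)) 2 (volume D • torusMeasure d) := by
    rw [← map_toTorus_restrict C.isAddFundamentalDomain_parallelepiped hfin,
      memLp_map_measure_iff hsm.aestronglyMeasurable C.measurable_toTorus.aemeasurable]
    have hK : IsCompact (closure D) :=
      (ZSpan.fundamentalDomain_isBounded C.Y).isCompact_closure
    refine ((f.2.1 _ hK).mono_measure (Measure.restrict_mono_set _ subset_closure)).ae_eq
      (ae_restrict_of_ae (comp_lift_toTorus f).symm)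
  have h2 := h1.smul_measure (c := (volume D)⁻¹) (ENNReal.inv_ne_top.2 h0)
  rwa [smul_smul, ENNReal.inv_mul_cancel h0 hfin, one_smul] at h2

lemma pull_injective : Function.Injective (pull C (F := F)) := by
  intro f g h
  have h1 : f ∘ C.toTorus =ᵐ[volume] g ∘ C.toTorus :=
    (coeFn_pull C f).symm.trans (by rw [h]; exact coeFn_pull C g)
  refine Lp.ext ?_
  have h2 := ae_restrict_of_ae (s := C.V) h1
  have h3 : ∀ᵐ θ ∂((volume.restrict C.V).map C.toTorus), f θ = g θ := by
    have hm : MeasurableSet {θ | f θ = g θ} :=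
      (Lp.stronglyMeasurable f).measurableSet_eq_fun (Lp.stronglyMeasurable g)
    exact (ae_map_iff C.measurable_toTorus.aemeasurable hm).2 h2
  rw [C.map_toTorus] at h3
  exact (Measure.absolutelyContinuous_smul C.volume_ne_zero).ae_le h3

lemma pull_surjective : Function.Surjective (pull C (F := F)) := by
  intro f
  refine ⟨(memLp_comp_lift f).toLp _, L2per_ext ?_⟩
  refine (coeFn_pull C _).trans (Filter.EventuallyEq.trans ?_ (comp_lift_toTorus f))
  exact C.quasiMeasurePreserving_toTorus.ae_eq_comp (MemLp.coeFn_toLp (memLp_comp_lift f))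

/-- `L²_per` is the space of square integrable functions on the torus. -/
def pullEquiv (F : Type*) [NormedAddCommGroup F] [NormedSpace ℝ F] :
    Lp F 2 (torusMeasure d) ≃ₗ[ℝ] L2per C F :=
  LinearEquiv.ofBijective (pull C) ⟨pull_injective C, pull_surjective C⟩

lemma pullEquiv_apply (g : Lp F 2 (torusMeasure d)) : pullEquiv C F g = pull C g := rfl

variable {C} in
lemma memLp_cell (f : L2per C F) : MemLp f 2 (volume.restrict C.V) := by
  obtain ⟨g, rfl⟩ := pull_surjective C f
  exact (memLp_comp_toTorus_restrict C.isAddFundamentalDomain C.volume_ne_top (Lp.memLp g)).ae_eq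
    (ae_restrict_of_ae (coeFn_pull C g).symm)

lemma setAverage_inner_pull {G : Type*} [NormedAddCommGroup G] [InnerProductSpace ℝ G]
    (f g : Lp G 2 (torusMeasure d)) :
    ⨍ x in C.V, inner ℝ (pull C f x) (pull C g x) ∂volume = inner ℝ f g := by
  rw [L2.inner_def, ← setAverage_comp_toTorus C
    ((Lp.memLp f).1.inner (Lp.memLp g).1)]
  refine average_congr (ae_restrict_of_ae ?_)
  filter_upwards [coeFn_pull C f, coeFn_pull C g] with x h1 h2
  rw [h1, h2]; rfl

end

end Homogenization

/-! ### Periodic test functions and trigonometric monomials. -/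

namespace Homogenization

noncomputable section

/-- The trigonometric Hilbert basis of `L²` of the torus. -/
def torusBasis (d : ℕ) : HilbertBasis (Fin d → ℤ) ℂ (Lp ℂ 2 (torusMeasure d)) :=
  UnitAddTorus.mFourierBasis

lemma coeFn_torusBasis {d : ℕ} (k : Fin d → ℤ) :
    (torusBasis d k : UnitAddTorus (Fin d) → ℂ) =ᵐ[torusMeasure d] UnitAddTorus.mFourier k := by
  have h := UnitAddTorus.coeFn_mFourierLp (d := Fin d) 2 k
  rw [← UnitAddTorus.coe_mFourierBasis] at h
  exact h

variable {d : ℕ} (C : UnitCell d)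

lemma setIntegral_comp_toTorus {E : Type*} [NormedAddCommGroup E] [NormedSpace ℝ E]
    {h : UnitAddTorus (Fin d) → E} (hh : AEStronglyMeasurable h (torusMeasure d)) :
    ∫ x in C.V, h (C.toTorus x) = volume.real C.V • ∫ θ, h θ ∂torusMeasure d := by
  rw [← setAverage_comp_toTorus C hh, measure_smul_setAverage _ C.volume_ne_top]

lemma UnitCell.isBounded_range_lift : Bornology.IsBounded (Set.range C.lift) := by
  refine (Metric.isBounded_closedBall (x := (0 : Pt d)) (r := ∑ i, ‖C.Y i‖)).subset ?_
  rintro _ ⟨θ, rfl⟩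
  rw [mem_closedBall_zero_iff]
  refine (norm_sum_le _ _).trans (Finset.sum_le_sum fun i _ => ?_)
  have h := (AddCircle.equivIco 1 0 (θ i)).2
  rw [norm_smul, Real.norm_of_nonneg h.1]
  exact mul_le_of_le_one_left (norm_nonneg _) (by simpa using h.2.le)

variable {C} {E : Type*} [NormedAddCommGroup E]

lemma comp_lift_of_periodic {X : Type*} {ψ : Pt d → X}
    (hper : ∀ v ∈ C.lattice, ∀ x, ψ (x + v) = ψ x)
    (x : Pt d) : ψ (C.lift (C.toTorus x)) = ψ x := by
  simpa using hper _ (C.lift_toTorus_sub_mem x) x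

lemma exists_bound_of_periodic {ψ : Pt d → E} (hψ : Continuous ψ)
    (hper : ∀ v ∈ C.lattice, ∀ x, ψ (x + v) = ψ x) : ∃ M, ∀ x, ‖ψ x‖ ≤ M := by
  obtain ⟨M, hM⟩ := C.isBounded_range_lift.isCompact_closure.exists_bound_of_continuousOn
    hψ.continuousOn
  refine ⟨M, fun x => ?_⟩
  rw [← comp_lift_of_periodic hper x]
  exact hM _ (subset_closure ⟨_, rfl⟩)

lemma memLp_top_of_periodic {ψ : Pt d → E} (hψ : Continuous ψ)
    (hper : ∀ v ∈ C.lattice, ∀ x, ψ (x + v) = ψ x) : MemLp ψ ⊤ (volume.restrict C.V) := by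
  obtain ⟨M, hM⟩ := exists_bound_of_periodic hψ hper
  exact memLp_top_of_bound hψ.aestronglyMeasurable M (Filter.Eventually.of_forall hM)

lemma integrable_of_periodic {ψ : Pt d → E} (hψ : Continuous ψ)
    (hper : ∀ v ∈ C.lattice, ∀ x, ψ (x + v) = ψ x) : Integrable ψ (volume.restrict C.V) :=
  (memLp_top_of_periodic hψ hper).integrable le_top

lemma aestronglyMeasurable_comp_lift {ψ : Pt d → E} (hψ : Continuous ψ) :
    AEStronglyMeasurable (fun θ => ψ (C.lift θ)) (torusMeasure d) :=
  (hψ.stronglyMeasurable.comp_measurable C.measurable_lift).aestronglyMeasurable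

lemma memLp_comp_lift_of_periodic {ψ : Pt d → E} (hψ : Continuous ψ)
    (hper : ∀ v ∈ C.lattice, ∀ x, ψ (x + v) = ψ x) :
    MemLp (fun θ => ψ (C.lift θ)) 2 (torusMeasure d) := by
  obtain ⟨M, hM⟩ := exists_bound_of_periodic hψ hper
  exact MemLp.of_bound (aestronglyMeasurable_comp_lift hψ) M
    (Filter.Eventually.of_forall fun θ => hM _)

namespace IsPeriodicTest

variable {φ ψ : Pt d → ℝ}

lemma continuous (hφ : IsPeriodicTest C φ) : Continuous φ := hφ.1.continuous

lemma differentiable (hφ : IsPeriodicTest C φ) : Differentiable ℝ φ :=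
  hφ.1.differentiable (by simp)

lemma hasDerivAt_line (hφ : IsPeriodicTest C φ) (j : Fin d) (x : Pt d) (t : ℝ) :
    HasDerivAt (fun t : ℝ => φ (x + t • EuclideanSpace.single j 1))
      (partialDeriv j φ (x + t • EuclideanSpace.single j 1)) t := by
  have h1 : HasDerivAt (fun t : ℝ => x + t • (EuclideanSpace.single j 1 : Pt d))
      (EuclideanSpace.single j 1) t := by
    simpa using ((hasDerivAt_id t).smul_const (EuclideanSpace.single j 1 : Pt d)).const_add x
  exact (hφ.differentiable _).hasFDerivAt.comp_hasDerivAt t h1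

lemma continuous_partialDeriv (hφ : IsPeriodicTest C φ) (j : Fin d) :
    Continuous (partialDeriv j φ) :=
  (hφ.1.continuous_fderiv (by simp)).clm_apply continuous_const

lemma periodic_partialDeriv (hφ : IsPeriodicTest C φ) (j : Fin d) :
    ∀ v ∈ C.lattice, ∀ x, partialDeriv j φ (x + v) = partialDeriv j φ x := by
  intro v hv x
  have h : (fun y => φ (y + v)) = φ := funext fun y => hφ.2 v hv y
  unfold partialDeriv
  rw [← fderiv_comp_add_right v, h]

lemma mul (hφ : IsPeriodicTest C φ) (hψ : IsPeriodicTest C ψ) :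
    IsPeriodicTest C (fun x => φ x * ψ x) :=
  ⟨hφ.1.mul hψ.1, fun v hv x => by simp only [hφ.2 v hv, hψ.2 v hv]⟩

lemma partialDeriv_mul (hφ : IsPeriodicTest C φ) (hψ : IsPeriodicTest C ψ) (j : Fin d)
    (x : Pt d) : partialDeriv j (fun x => φ x * ψ x) x =
      φ x * partialDeriv j ψ x + ψ x * partialDeriv j φ x := by
  unfold partialDeriv
  rw [fderiv_fun_mul (hφ.differentiable x) (hψ.differentiable x)]
  simp

/-- The mean over the cell of the derivative of a periodic function vanishes. -/
lemma setIntegral_partialDeriv (hφ : IsPeriodicTest C φ) (j : Fin d) :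
    ∫ x in C.V, partialDeriv j φ x = 0 := by
  set e : Pt d := EuclideanSpace.single j 1
  obtain ⟨M, hM⟩ := exists_bound_of_periodic (hφ.continuous_partialDeriv j)
    (hφ.periodic_partialDeriv j)
  have hder := (hasDerivAt_integral_of_dominated_loc_of_deriv_le (μ := volume.restrict C.V)
    (F := fun t x => φ (x + t • e)) (F' := fun t x => partialDeriv j φ (x + t • e))
    (x₀ := (0 : ℝ)) (s := Set.univ) (bound := fun _ => M) Filter.univ_mem
    (Filter.Eventually.of_forall fun t =>
      (hφ.continuous.comp (continuous_add_const _)).aestronglyMeasurable)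
    (by simpa using integrable_of_periodic hφ.continuous hφ.2)
    ((hφ.continuous_partialDeriv j).comp (continuous_add_const _)).aestronglyMeasurable
    (Filter.Eventually.of_forall fun x t _ => hM _) (integrable_const M)
    (Filter.Eventually.of_forall fun x t _ => hφ.hasDerivAt_line j x t)).2
  -- Translations of space induce translations of the torus, which preserve Haar measure. Hence
  -- `hder` differentiates a constant, and no divergence theorem or boundary regularity of the cell
  -- is needed.
  have hconst : ∀ t : ℝ, ∫ x in C.V, φ (x + t • e) = ∫ x in C.V, φ x := by
    intro t
    have h1 : ∀ x, φ (x + t • e) = φ (C.lift (C.toTorus x + C.toTorus (t • e))) := fun x => by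
      rw [← map_add, comp_lift_of_periodic hφ.2]
    have h2 : ∀ x, φ x = φ (C.lift (C.toTorus x)) := fun x =>
      (comp_lift_of_periodic hφ.2 x).symm
    have hm : StronglyMeasurable fun θ => φ (C.lift θ) :=
      hφ.continuous.stronglyMeasurable.comp_measurable C.measurable_lift
    simp_rw [h1]
    rw [setIntegral_comp_toTorus C (h := fun θ => φ (C.lift (θ + C.toTorus (t • e))))
      (hm.comp_measurable (measurable_add_const _)).aestronglyMeasurable,
      integral_add_right_eq_self (fun θ => φ (C.lift θ)),
      ← setIntegral_comp_toTorus C hm.aestronglyMeasurable]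
    simp_rw [← h2]
  simp only [hconst, zero_smul, add_zero] at hder
  exact hder.unique (hasDerivAt_const _ _)

/-- Integration by parts over the cell. -/
lemma setIntegral_mul_partialDeriv (hφ : IsPeriodicTest C φ) (hψ : IsPeriodicTest C ψ)
    (j : Fin d) :
    ∫ x in C.V, φ x * partialDeriv j ψ x = - ∫ x in C.V, ψ x * partialDeriv j φ x := by
  have h := (hφ.mul hψ).setIntegral_partialDeriv j
  simp_rw [hφ.partialDeriv_mul hψ] at h
  rw [integral_add] at h
  · linarith
  · exact integrable_of_periodic (hφ.continuous.mul (hψ.continuous_partialDeriv j))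
      fun v hv x => by rw [hφ.2 v hv, hψ.periodic_partialDeriv j v hv]
  · exact integrable_of_periodic (hψ.continuous.mul (hφ.continuous_partialDeriv j))
      fun v hv x => by rw [hψ.2 v hv, hφ.periodic_partialDeriv j v hv]

end IsPeriodicTest

variable (C)

/-- The phase of the `k`-th trigonometric monomial. -/
def UnitCell.phase (k : Fin d → ℤ) : Pt d →L[ℝ] ℝ :=
  LinearMap.toContinuousLinearMap ((2 * Real.pi) • ∑ i, (k i : ℝ) • C.Y.coord i)

lemma UnitCell.phase_apply (k : Fin d → ℤ) (x : Pt d) :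
    C.phase k x = 2 * Real.pi * ∑ i, (k i : ℝ) * C.Y.repr x i := by
  simp [UnitCell.phase]

/-- The wave vector of the `k`-th trigonometric monomial. -/
def UnitCell.freq (k : Fin d → ℤ) (j : Fin d) : ℝ := C.phase k (EuclideanSpace.single j 1)

lemma UnitCell.mFourier_toTorus (k : Fin d → ℤ) (x : Pt d) :
    UnitAddTorus.mFourier k (C.toTorus x) = Complex.exp (C.phase k x * Complex.I) := by
  simp only [UnitAddTorus.mFourier, ContinuousMap.coe_mk, C.toTorus_apply, fourier_coe_apply]
  rw [← Complex.exp_sum, C.phase_apply]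
  congr 1
  push_cast
  rw [Finset.mul_sum, Finset.sum_mul]
  refine Finset.sum_congr rfl fun i _ => ?_
  ring

lemma UnitCell.phase_lattice (k : Fin d → ℤ) {v : Pt d} (hv : v ∈ C.lattice) :
    ∃ n : ℤ, C.phase k v = n * (2 * Real.pi) := by
  rw [UnitCell.lattice, C.Y.mem_span_iff_repr_mem ℤ] at hv
  choose m hm using hv
  refine ⟨∑ i, k i * m i, ?_⟩
  rw [C.phase_apply, mul_comm]
  push_cast
  congr 1
  refine Finset.sum_congr rfl fun i _ => ?_
  rw [← hm i]; simp

lemma UnitCell.isPeriodicTest_cos (k : Fin d → ℤ) :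
    IsPeriodicTest C fun x => Real.cos (C.phase k x) := by
  refine ⟨Real.contDiff_cos.comp (C.phase k).contDiff, fun v hv x => ?_⟩
  obtain ⟨n, hn⟩ := C.phase_lattice k hv
  simp only [map_add, hn, Real.cos_add_int_mul_two_pi]

lemma UnitCell.isPeriodicTest_sin (k : Fin d → ℤ) :
    IsPeriodicTest C fun x => Real.sin (C.phase k x) := by
  refine ⟨Real.contDiff_sin.comp (C.phase k).contDiff, fun v hv x => ?_⟩
  obtain ⟨n, hn⟩ := C.phase_lattice k hv
  simp only [map_add, hn, Real.sin_add_int_mul_two_pi]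

lemma UnitCell.partialDeriv_cos (k : Fin d → ℤ) (j : Fin d) (x : Pt d) :
    partialDeriv j (fun x => Real.cos (C.phase k x)) x =
      -(C.freq k j * Real.sin (C.phase k x)) := by
  unfold partialDeriv
  rw [((C.phase k).hasFDerivAt.cos).fderiv]
  simp [UnitCell.freq, mul_comm]

lemma UnitCell.partialDeriv_sin (k : Fin d → ℤ) (j : Fin d) (x : Pt d) :
    partialDeriv j (fun x => Real.sin (C.phase k x)) x =
      C.freq k j * Real.cos (C.phase k x) := by
  unfold partialDeriv
  rw [((C.phase k).hasFDerivAt.sin).fderiv]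
  simp [UnitCell.freq, mul_comm]

lemma UnitCell.freq_zero (j : Fin d) : C.freq 0 j = 0 := by
  simp [UnitCell.freq, C.phase_apply]

lemma UnitCell.phase_eq_sum (k : Fin d → ℤ) (x : Pt d) :
    C.phase k x = ∑ j, x j * C.freq k j := by
  conv_lhs => rw [← (EuclideanSpace.basisFun (Fin d) ℝ).sum_repr x]
  simp [UnitCell.freq]

/-- The nonzero wave vectors are bounded away from zero. -/
lemma UnitCell.exists_le_sum_freq_sq :
    ∃ c : ℝ, 0 < c ∧ ∀ k : Fin d → ℤ, k ≠ 0 → c ≤ ∑ j, C.freq k j ^ 2 := by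
  set M : ℝ := 1 + ∑ i, ∑ j, C.Y i j ^ 2
  have hM : 0 < M := by positivity
  refine ⟨(2 * Real.pi) ^ 2 / M, by positivity, fun k hk => ?_⟩
  obtain ⟨i, hi⟩ := Function.ne_iff.1 hk
  -- The phase of the generator `Y i` is `2π k i`, at least `2π` in modulus for a nonzero integer;
  -- Cauchy–Schwarz bounds it by `|Y i|` times the length of the wave vector.
  have h1 : (2 * Real.pi * k i) = ∑ j, C.Y i j * C.freq k j := by
    rw [← C.phase_eq_sum, C.phase_apply]
    simp [Finsupp.single_apply]
  have h2 := Finset.sum_mul_sq_le_sq_mul_sq Finset.univ (fun j => C.Y i j) (C.freq k)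
  rw [← h1] at h2
  have h3 : ∑ j, C.Y i j ^ 2 ≤ M := by
    have := Finset.single_le_sum (f := fun i => ∑ j, C.Y i j ^ 2)
      (fun i _ => Finset.sum_nonneg fun j _ => sq_nonneg _) (Finset.mem_univ i)
    simp only [M]
    linarith
  have h4 : (1 : ℝ) ≤ (k i : ℝ) ^ 2 := by
    have : (1 : ℤ) ≤ k i ^ 2 := by
      have := sq_pos_of_ne_zero hi
      omega
    exact_mod_cast this
  have h5 : 0 ≤ ∑ j, C.freq k j ^ 2 := Finset.sum_nonneg fun j _ => sq_nonneg _
  rw [div_le_iff₀ hM]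
  have h6 : (2 * Real.pi) ^ 2 ≤ (2 * Real.pi * k i) ^ 2 := by
    rw [mul_pow _ (k i : ℝ)]
    exact le_mul_of_one_le_right (sq_nonneg _) h4
  nlinarith [mul_le_mul_of_nonneg_right h3 h5]

end

end Homogenization

/-! ### Fourier coefficients and weak derivatives. -/

namespace Homogenization

noncomputable section

variable {d : ℕ} {C : UnitCell d}

/-- Fourier coefficients of real functions on the torus. -/
def fourierCoef (k : Fin d → ℤ) : Lp ℝ 2 (torusMeasure d) →L[ℝ] ℂ :=
  ((innerSL ℂ (torusBasis d k)).restrictScalars ℝ).comp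
    (Complex.ofRealCLM.compLpL 2 (torusMeasure d))

lemma fourierCoef_apply (k : Fin d → ℤ) (u : Lp ℝ 2 (torusMeasure d)) :
    fourierCoef k u = inner ℂ (torusBasis d k) (Complex.ofRealCLM.compLpL 2 (torusMeasure d) u) :=
  rfl

-- Weak derivatives are tested against real functions only, so the coefficient is split into cosine
-- and sine integrals.
variable (C) in
lemma fourierCoef_eq (k : Fin d → ℤ) (u : Lp ℝ 2 (torusMeasure d)) :
    fourierCoef k u = (volume.real C.V : ℂ)⁻¹ *
      ((∫ x in C.V, pull C u x * Real.cos (C.phase k x) : ℝ)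
        - Complex.I * (∫ x in C.V, pull C u x * Real.sin (C.phase k x) : ℝ)) := by
  have hu := memLp_cell (pull C u)
  have hint : ∀ ψ : Pt d → ℝ, IsPeriodicTest C ψ →
      Integrable (fun x => pull C u x * ψ x) (volume.restrict C.V) := fun ψ hψ =>
    (hu.integrable (by simp)).mul_of_top_left (memLp_top_of_periodic hψ.continuous hψ.2)
  rw [fourierCoef_apply, L2.inner_def, ← setAverage_comp_toTorus C
    ((Lp.memLp _).1.inner (Lp.memLp _).1), setAverage_eq, Complex.real_smul, Complex.ofReal_inv,
    ← integral_complex_ofReal, ← integral_complex_ofReal, ← integral_const_mul Complex.I,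
    ← integral_sub (hint _ (C.isPeriodicTest_cos k)).ofReal
      ((hint _ (C.isPeriodicTest_sin k)).ofReal.const_mul _)]
  congr 1
  refine integral_congr_ae (ae_restrict_of_ae ?_)
  filter_upwards [coeFn_pull C u,
    C.quasiMeasurePreserving_toTorus.ae_eq_comp (coeFn_torusBasis k),
    C.quasiMeasurePreserving_toTorus.ae_eq_comp
      (Complex.ofRealCLM.coeFn_compLpL (p := 2) u)] with x h1 h2 h3
  simp only [Function.comp_apply] at h1 h2 h3
  rw [h1, h2, h3, C.mFourier_toTorus, RCLike.inner_apply, Complex.exp_mul_I]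
  simp only [Complex.ofRealCLM_apply, map_add, map_mul, Complex.conj_I, ← Complex.ofReal_cos,
    ← Complex.ofReal_sin, Complex.conj_ofReal]
  push_cast
  ring

/-- Fourier coefficients of weak derivatives. -/
lemma IsWeakPartial.fourierCoef_eq {j : Fin d} {f g : Lp ℝ 2 (torusMeasure d)}
    (h : IsWeakPartial C j (pull C f) (pull C g)) (k : Fin d → ℤ) :
    fourierCoef k g = Complex.I * (C.freq k j * fourierCoef k f) := by
  have h1 := h _ (C.isPeriodicTest_cos k)
  have h2 := h _ (C.isPeriodicTest_sin k)
  simp_rw [C.partialDeriv_cos k j] at h1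
  simp_rw [C.partialDeriv_sin k j] at h2
  have e1 : ∀ x, pull C f x * -(C.freq k j * Real.sin (C.phase k x)) =
    - C.freq k j * (pull C f x * Real.sin (C.phase k x)) := fun x => by ring
  have e2 : ∀ x, pull C f x * (C.freq k j * Real.cos (C.phase k x)) =
    C.freq k j * (pull C f x * Real.cos (C.phase k x)) := fun x => by ring
  simp_rw [e1] at h1
  simp_rw [e2] at h2
  rw [integral_const_mul] at h1 h2
  rw [neg_mul, neg_inj] at h1
  rw [eq_neg_iff_add_eq_zero, add_comm, ← eq_neg_iff_add_eq_zero] at h2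
  rw [Homogenization.fourierCoef_eq C, Homogenization.fourierCoef_eq C, ← h1, h2]
  push_cast
  linear_combination ((volume.real C.V : ℂ)⁻¹ * C.freq k j *
    (∫ x in C.V, pull C f x * Real.sin (C.phase k x) : ℝ)) * Complex.I_sq

/-- A continuous periodic function, as a square integrable function on the torus. -/
def periodicLp {ψ : Pt d → ℝ} (hψ : Continuous ψ)
    (hper : ∀ v ∈ C.lattice, ∀ x, ψ (x + v) = ψ x) : Lp ℝ 2 (torusMeasure d) :=
  (memLp_comp_lift_of_periodic hψ hper).toLp _

lemma coeFn_pull_periodicLp {ψ : Pt d → ℝ} (hψ : Continuous ψ)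
    (hper : ∀ v ∈ C.lattice, ∀ x, ψ (x + v) = ψ x) :
    (pull C (periodicLp hψ hper) : Pt d → ℝ) =ᵐ[volume] ψ := by
  filter_upwards [coeFn_pull C (periodicLp hψ hper),
    C.quasiMeasurePreserving_toTorus.ae_eq_comp
      (memLp_comp_lift_of_periodic hψ hper).coeFn_toLp] with x h1 h2
  rw [h1]
  exact h2.trans (comp_lift_of_periodic hper x)

lemma IsPeriodicTest.isWeakPartial {φ : Pt d → ℝ} (hφ : IsPeriodicTest C φ) (j : Fin d) :
    IsWeakPartial C j (pull C (periodicLp hφ.continuous hφ.2))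
      (pull C (periodicLp (hφ.continuous_partialDeriv j) (hφ.periodic_partialDeriv j))) := by
  intro ψ hψ
  have h := hφ.setIntegral_mul_partialDeriv hψ j
  refine Eq.trans (integral_congr_ae (ae_restrict_of_ae ?_)) (h.trans (congrArg _
    (integral_congr_ae (ae_restrict_of_ae ?_))))
  · filter_upwards [coeFn_pull_periodicLp hφ.continuous hφ.2] with x hx
    rw [hx]
  · filter_upwards [coeFn_pull_periodicLp (hφ.continuous_partialDeriv j)
      (hφ.periodic_partialDeriv j)] with x hx
    rw [hx, mul_comm]

/-- Fields rebuilt from Fourier coefficients are complex. Taking real parts commutes with pairing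
against a real function, so their reality never has to be proved. -/
lemma inner_compLpL_re (u : Lp ℝ 2 (torusMeasure d)) (f : Lp ℂ 2 (torusMeasure d)) :
    inner ℝ u (Complex.reCLM.compLpL 2 (torusMeasure d) f) =
      (inner ℂ (Complex.ofRealCLM.compLpL 2 (torusMeasure d) u) f).re := by
  rw [L2.inner_def, L2.inner_def]
  refine Eq.trans ?_ (integral_re (L2.integrable_inner (𝕜 := ℂ) _ _))
  refine integral_congr_ae ?_
  filter_upwards [Complex.ofRealCLM.coeFn_compLpL (p := 2) u,
    Complex.reCLM.coeFn_compLpL (p := 2) f] with θ h1 h2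
  rw [h1, h2]
  simp [RCLike.inner_apply]

lemma setIntegral_pull_mul (f : Lp ℝ 2 (torusMeasure d)) {ψ : Pt d → ℝ} (hψ : Continuous ψ)
    (hper : ∀ v ∈ C.lattice, ∀ x, ψ (x + v) = ψ x) :
    ∫ x in C.V, pull C f x * ψ x = volume.real C.V * inner ℝ (periodicLp hψ hper) f := by
  rw [← setAverage_inner_pull C, ← smul_eq_mul, measure_smul_setAverage _ C.volume_ne_top]
  refine integral_congr_ae (ae_restrict_of_ae ?_)
  filter_upwards [coeFn_pull_periodicLp hψ hper] with x hx
  rw [hx]; simp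

/-- Weak derivatives are detected by Fourier coefficients. -/
lemma isWeakPartial_of_fourier {j : Fin d} {f g : Lp ℂ 2 (torusMeasure d)}
    (h : ∀ k, inner ℂ (torusBasis d k) g =
      Complex.I * (C.freq k j * inner ℂ (torusBasis d k) f)) :
    IsWeakPartial C j (pull C (Complex.reCLM.compLpL 2 (torusMeasure d) f))
      (pull C (Complex.reCLM.compLpL 2 (torusMeasure d) g)) := by
  intro φ hφ
  rw [setIntegral_pull_mul _ hφ.continuous hφ.2, setIntegral_pull_mul _
    (hφ.continuous_partialDeriv j) (hφ.periodic_partialDeriv j), inner_compLpL_re,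
    inner_compLpL_re, ← mul_neg, ← Complex.neg_re]
  congr 2
  -- Parseval on both sides; the sign of the integration by parts is that of `I` under conjugation.
  rw [← (torusBasis d).tsum_inner_mul_inner, ← (torusBasis d).tsum_inner_mul_inner, ← tsum_neg]
  refine tsum_congr fun k => ?_
  rw [← inner_conj_symm, ← fourierCoef_apply, (hφ.isWeakPartial j).fourierCoef_eq k, h k,
    ← inner_conj_symm _ (torusBasis d k), ← fourierCoef_apply]
  simp only [map_mul, Complex.conj_I, Complex.conj_ofReal]
  ring

end

end Homogenization

/-! ### Fourier characterization and closedness of the compatible strains. -/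

namespace Homogenization

noncomputable section

variable {d : ℕ} {C : UnitCell d}

/-- The right side exceeds the left by `(ξ · a)²`, the sum of the cross terms. -/
lemma sum_sq_le_sum_sym_sq (ξ a : Fin d → ℝ) :
    ∑ i, ∑ j, (ξ j * a i) ^ 2 ≤ 2 * ∑ i, ∑ j, (1 / 2 * (ξ j * a i + ξ i * a j)) ^ 2 := by
  have h1 : 2 * ∑ i, ∑ j, (1 / 2 * (ξ j * a i + ξ i * a j)) ^ 2 =
      1 / 2 * ∑ i, ∑ j, (ξ j * a i) ^ 2 + 1 / 2 * ∑ i, ∑ j, (ξ i * a j) ^ 2 +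
        ∑ i, ∑ j, (ξ i * a i) * (ξ j * a j) := by
    simp only [Finset.mul_sum, ← Finset.sum_add_distrib]
    refine Finset.sum_congr rfl fun i _ => Finset.sum_congr rfl fun j _ => ?_
    ring
  rw [h1, Finset.sum_comm (f := fun i j => (ξ i * a j) ^ 2), ← Finset.sum_mul_sum]
  nlinarith [mul_self_nonneg (∑ i, ξ i * a i)]

/-- Korn's inequality for one Fourier mode. -/
lemma sum_norm_sq_le_sum_sym_norm_sq (ξ : Fin d → ℝ) (a : Fin d → ℂ) :
    ∑ i, ∑ j, ‖Complex.I * (ξ j * a i)‖ ^ 2 ≤ 2 * ∑ i, ∑ j,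
      ‖(1 / 2 : ℂ) * (Complex.I * (ξ j * a i) + Complex.I * (ξ i * a j))‖ ^ 2 := by
  have e1 : ∀ i j, ‖Complex.I * (ξ j * a i)‖ ^ 2 =
      (ξ j * (a i).re) ^ 2 + (ξ j * (a i).im) ^ 2 := fun i j => by
    rw [Complex.sq_norm, Complex.normSq_apply]; simp; ring
  have e2 : ∀ i j, ‖(1 / 2 : ℂ) * (Complex.I * (ξ j * a i) + Complex.I * (ξ i * a j))‖ ^ 2 =
      (1 / 2 * (ξ j * (a i).re + ξ i * (a j).re)) ^ 2 +
        (1 / 2 * (ξ j * (a i).im + ξ i * (a j).im)) ^ 2 := fun i j => by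
    rw [Complex.sq_norm, Complex.normSq_apply]; simp; ring
  simp_rw [e1, e2, Finset.sum_add_distrib]
  linarith [sum_sq_le_sum_sym_sq ξ fun i => (a i).re, sum_sq_le_sum_sym_sq ξ fun i => (a i).im]

/-- The `k`-th Fourier coefficients of symmetric gradients. -/
def symGradCoef (ξ : Fin d → ℝ) : (Fin d → ℂ) →ₗ[ℝ] (Fin d → Fin d → ℂ) where
  toFun a i j := (1 / 2 : ℂ) * (Complex.I * (ξ j * a i) + Complex.I * (ξ i * a j))
  map_add' a b := by ext i j; simp; ring
  map_smul' c a := by ext i j; simp; ring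

/-- The component `(i, j)` of a symmetric tensor. -/
def component (i j : Fin d) : SymT d →L[ℝ] ℝ :=
  (EuclideanSpace.proj (i, j) : Tens2 d →L[ℝ] ℝ).comp (SymT d).subtypeL

lemma component_apply (i j : Fin d) (e : SymT d) : component i j e = (e : Tens2 d) (i, j) := rfl

/-- The Fourier coefficients of the components of a tensor field. -/
def tensorCoef (k : Fin d → ℤ) : Lp (SymT d) 2 (torusMeasure d) →L[ℝ] (Fin d → Fin d → ℂ) :=
  ContinuousLinearMap.pi fun i => ContinuousLinearMap.pi fun j =>
    (fourierCoef k).comp ((component i j).compLpL 2 (torusMeasure d))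

lemma tensorCoef_apply (k : Fin d → ℤ) (u : Lp (SymT d) 2 (torusMeasure d)) (i j : Fin d) :
    tensorCoef k u i j = fourierCoef k ((component i j).compLpL 2 (torusMeasure d) u) := rfl

lemma coeFn_pull_component (i j : Fin d) (u : Lp (SymT d) 2 (torusMeasure d)) :
    (fun x => (pull C u x : Tens2 d) (i, j)) =ᵐ[volume]
      pull C ((component i j).compLpL 2 (torusMeasure d) u) := by
  filter_upwards [coeFn_pull C u, coeFn_pull C ((component i j).compLpL 2 (torusMeasure d) u),
    C.quasiMeasurePreserving_toTorus.ae_eq_comp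
      ((component i j).coeFn_compLpL (p := 2) u)] with x h1 h2 h3
  simp only [Function.comp_apply] at h1 h2 h3
  rw [h1, h2, h3, component_apply]

lemma tensorCoef_mem_of_mem_compatibleStrains {u : Lp (SymT d) 2 (torusMeasure d)}
    (hu : pull C u ∈ compatibleStrains C) (k : Fin d → ℤ) :
    tensorCoef k u ∈ LinearMap.range (symGradCoef (C.freq k)) := by
  obtain ⟨w, G, hw, hG⟩ := hu
  choose f hf using fun i => pull_surjective C (w i)
  choose g hg using fun i j => pull_surjective C (G i j)
  refine ⟨fun i => fourierCoef k (f i), ?_⟩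
  ext i j
  have h1 : ∀ i j, fourierCoef k (g i j) = Complex.I * (C.freq k j * fourierCoef k (f i)) :=
    fun i j => IsWeakPartial.fourierCoef_eq (by rw [hf, hg]; exact hw i j) k
  have h2 : (component i j).compLpL 2 (torusMeasure d) u =
      (1 / 2 : ℝ) • (g i j + g j i) := by
    refine pull_injective C (L2per_ext ?_)
    rw [map_smul, map_add, hg, hg]
    filter_upwards [hG, coeFn_pull_component (C := C) i j u,
      AEEqFun.coeFn_smul (1 / 2 : ℝ) ((G i j + G j i : L2per C ℝ) : Pt d →ₘ[volume] ℝ),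
      AEEqFun.coeFn_add (G i j : Pt d →ₘ[volume] ℝ) (G j i : Pt d →ₘ[volume] ℝ)] with x h3 h4 h5 h6
    rw [← h4, h3 i j]
    refine Eq.symm (h5.trans ?_)
    rw [Pi.smul_apply, smul_eq_mul]
    congr 1
  rw [tensorCoef_apply, h2, map_smul, map_add, h1, h1]
  simp [symGradCoef]
  ring

lemma summable_norm_sq_fourierCoef (u : Lp ℝ 2 (torusMeasure d)) :
    Summable fun k => ‖fourierCoef k u‖ ^ 2 := by
  have h := lp.memℓp ((torusBasis d).repr (Complex.ofRealCLM.compLpL 2 (torusMeasure d) u))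
  have h2 := h.summable (by norm_num)
  refine h2.congr fun k => ?_
  rw [(torusBasis d).repr_apply_apply, fourierCoef_apply]
  norm_num

lemma exists_inner_torusBasis_eq {c : (Fin d → ℤ) → ℂ} (hc : Summable fun k => ‖c k‖ ^ 2) :
    ∃ f : Lp ℂ 2 (torusMeasure d), ∀ k, inner ℂ (torusBasis d k) f = c k := by
  have hm : Memℓp c 2 := memℓp_gen (by simpa using hc)
  refine ⟨(torusBasis d).repr.symm ⟨c, hm⟩, fun k => ?_⟩
  rw [← (torusBasis d).repr_apply_apply, LinearIsometryEquiv.apply_symm_apply]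

/-- The amplitudes `a k` are the Fourier coefficients of the sought displacement. Square summability
of the coefficients of `u` passes to the gradient by Korn's inequality for each mode, then to the
displacement by `exists_le_sum_freq_sq`. -/
lemma mem_compatibleStrains_of_tensorCoef_mem {u : Lp (SymT d) 2 (torusMeasure d)}
    (hu : ∀ k, tensorCoef k u ∈ LinearMap.range (symGradCoef (C.freq k))) :
    pull C u ∈ compatibleStrains C := by
  choose a ha using hu
  have hsum : Summable fun k => 2 * ∑ i, ∑ j, ‖tensorCoef k u i j‖ ^ 2 :=
    (summable_sum fun i _ => summable_sum fun j _ => summable_norm_sq_fourierCoef _).mul_left 2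
  have hkorn : ∀ k, ∑ i, ∑ j, ‖Complex.I * (C.freq k j * a k i)‖ ^ 2 ≤
      2 * ∑ i, ∑ j, ‖tensorCoef k u i j‖ ^ 2 := fun k => by
    rw [← ha k]; exact sum_norm_sq_le_sum_sym_norm_sq _ _
  have hrow : ∀ k i, ∑ j, ‖Complex.I * (C.freq k j * a k i)‖ ^ 2 ≤
      2 * ∑ i, ∑ j, ‖tensorCoef k u i j‖ ^ 2 := fun k i =>
    (Finset.single_le_sum (f := fun i => ∑ j, ‖Complex.I * (C.freq k j * a k i)‖ ^ 2)
      (fun i _ => Finset.sum_nonneg fun j _ => sq_nonneg _) (Finset.mem_univ i)).trans (hkorn k)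
  have hentry : ∀ i j k, ‖Complex.I * (C.freq k j * a k i)‖ ^ 2 ≤
      2 * ∑ i, ∑ j, ‖tensorCoef k u i j‖ ^ 2 := fun i j k =>
    (Finset.single_le_sum (f := fun j => ‖Complex.I * (C.freq k j * a k i)‖ ^ 2)
      (fun j _ => sq_nonneg _) (Finset.mem_univ j)).trans (hrow k i)
  have hG : ∀ i j, Summable fun k => ‖Complex.I * (C.freq k j * a k i)‖ ^ 2 := fun i j =>
    Summable.of_nonneg_of_le (fun k => sq_nonneg _) (hentry i j) hsum
  obtain ⟨c, hc, hfreq⟩ := C.exists_le_sum_freq_sq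
  -- The mode `k = 0` is a translation, which the strain does not control; since `C.freq 0 = 0`,
  -- discarding it leaves the gradient unchanged.
  have hW : ∀ i, Summable fun k => ‖if k = 0 then 0 else a k i‖ ^ 2 := fun i => by
    refine Summable.of_nonneg_of_le (fun k => sq_nonneg _) (fun k => ?_) (hsum.mul_left c⁻¹)
    by_cases hk : k = 0
    · rw [if_pos hk, norm_zero]
      simp only [ne_eq, OfNat.ofNat_ne_zero, not_false_eq_true, zero_pow]
      positivity
    · rw [if_neg hk, inv_mul_eq_div, le_div_iff₀ hc]
      refine le_trans ?_ (hrow k i)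
      have e : ∀ j, ‖Complex.I * (C.freq k j * a k i)‖ ^ 2 = ‖a k i‖ ^ 2 * C.freq k j ^ 2 :=
        fun j => by
          rw [norm_mul, norm_mul, Complex.norm_I, Complex.norm_real, one_mul, mul_pow,
            Real.norm_eq_abs, sq_abs, mul_comm]
      simp_rw [e, ← Finset.mul_sum]
      exact mul_le_mul_of_nonneg_left (hfreq k hk) (sq_nonneg _)
  choose W hW' using fun i => exists_inner_torusBasis_eq (hW i)
  choose G hG' using fun i j => exists_inner_torusBasis_eq (hG i j)
  -- The chosen amplitudes need not satisfy the reality condition. Real parts suffice because `u` is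
  -- real.
  refine ⟨fun i => pull C (Complex.reCLM.compLpL 2 (torusMeasure d) (W i)),
    fun i j => pull C (Complex.reCLM.compLpL 2 (torusMeasure d) (G i j)), fun i j => ?_, ?_⟩
  · refine isWeakPartial_of_fourier fun k => ?_
    rw [hG', hW']
    by_cases hk : k = 0
    · simp [hk, C.freq_zero]
    · rw [if_neg hk]
  · rw [ae_all_iff]
    intro i
    rw [ae_all_iff]
    intro j
    have h1 : Complex.ofRealCLM.compLpL 2 (torusMeasure d)
        ((component i j).compLpL 2 (torusMeasure d) u) = (1 / 2 : ℂ) • (G i j + G j i) := by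
      refine (torusBasis d).repr.injective (lp.ext (funext fun k => ?_))
      rw [(torusBasis d).repr_apply_apply, (torusBasis d).repr_apply_apply, ← fourierCoef_apply,
        ← tensorCoef_apply, ← ha k, inner_smul_right, inner_add_right, hG', hG']
      rfl
    filter_upwards [coeFn_pull_component (C := C) i j u,
      coeFn_pull C ((component i j).compLpL 2 (torusMeasure d) u),
      coeFn_pull C (Complex.reCLM.compLpL 2 (torusMeasure d) (G i j)),
      coeFn_pull C (Complex.reCLM.compLpL 2 (torusMeasure d) (G j i)),
      C.quasiMeasurePreserving_toTorus.ae_eq_comp (Complex.reCLM.coeFn_compLpL (p := 2) (G i j)),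
      C.quasiMeasurePreserving_toTorus.ae_eq_comp (Complex.reCLM.coeFn_compLpL (p := 2) (G j i)),
      C.quasiMeasurePreserving_toTorus.ae_eq_comp (Complex.ofRealCLM.coeFn_compLpL (p := 2)
        ((component i j).compLpL 2 (torusMeasure d) u)),
      C.quasiMeasurePreserving_toTorus.ae_eq_comp (Lp.coeFn_smul (1 / 2 : ℂ) (G i j + G j i)),
      C.quasiMeasurePreserving_toTorus.ae_eq_comp (Lp.coeFn_add (G i j) (G j i))]
      with x h2 h3 h4 h5 h6 h7 h8 h9 h10
    simp only [Function.comp_apply, Pi.smul_apply, Pi.add_apply] at *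
    rw [h2, h3, h4, h5, h6, h7]
    rw [h1, h9, h10] at h8
    have h11 := congrArg Complex.re h8
    simp at h11
    simp [← h11]

variable (C) in
/-- The compatible strain fields form a closed subspace. -/
lemma isClosed_compatibleStrains :
    IsClosed {u : Lp (SymT d) 2 (torusMeasure d) | pull C u ∈ compatibleStrains C} := by
  have h : {u : Lp (SymT d) 2 (torusMeasure d) | pull C u ∈ compatibleStrains C} =
      ⋂ k, tensorCoef k ⁻¹' (LinearMap.range (symGradCoef (C.freq k)) : Set _) := by
    ext u
    simp only [Set.mem_iInter]
    exact ⟨tensorCoef_mem_of_mem_compatibleStrains, mem_compatibleStrains_of_tensorCoef_mem⟩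
  rw [h]
  -- Each condition is the preimage, under a continuous map, of a subspace of a finite-dimensional
  -- space.
  exact isClosed_iInter fun k =>
    (Submodule.closed_of_finiteDimensional _).preimage (tensorCoef k).continuous

end

end Homogenization

/-! ### Energetic scalar products and existence of projections. -/

namespace Homogenization

noncomputable section

variable {d : ℕ} {C : UnitCell d}

/-- Positive definite forms in finite dimension are coercive. -/
lemma exists_coercive_of_pos {G : Type*} [NormedAddCommGroup G] [InnerProductSpace ℝ G]
    [ProperSpace G] (A : G →L[ℝ] G) (hA : ∀ e : G, e ≠ 0 → 0 < inner ℝ (A e) e) :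
    ∃ α : ℝ, 0 < α ∧ ∀ e : G, α * ‖e‖ ^ 2 ≤ inner ℝ (A e) e := by
  have hc : Continuous fun e : G => inner ℝ (A e) e := A.continuous.inner continuous_id
  by_cases hne : (Metric.sphere (0 : G) 1).Nonempty
  · obtain ⟨e₀, he₀, hmin⟩ := (isCompact_sphere (0 : G) 1).exists_isMinOn hne hc.continuousOn
    have h0 : e₀ ≠ 0 := by
      rintro rfl
      simp at he₀
    refine ⟨_, hA e₀ h0, fun e => ?_⟩
    by_cases he : e = 0
    · simp [he]
    have hn : ‖e‖ ≠ 0 := norm_ne_zero_iff.2 he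
    have h1 : inner ℝ (A e₀) e₀ ≤ inner ℝ (A (‖e‖⁻¹ • e)) (‖e‖⁻¹ • e) :=
      hmin (mem_sphere_zero_iff_norm.2 (norm_smul_inv_norm (𝕜 := ℝ) he))
    rw [map_smul, real_inner_smul_left, real_inner_smul_right] at h1
    have h2 := mul_le_mul_of_nonneg_right h1 (sq_nonneg ‖e‖)
    refine h2.trans (le_of_eq ?_)
    field_simp
  -- An empty unit sphere means the zero space (as for `d = 0`), where any constant works.
  · refine ⟨1, one_pos, fun e => ?_⟩
    have he : e = 0 := by
      by_contra he
      exact hne ⟨‖e‖⁻¹ • e, mem_sphere_zero_iff_norm.2 (norm_smul_inv_norm (𝕜 := ℝ) he)⟩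
    simp [he]

lemma IsElasticTensor.exists_coercive {A : Tens4 d} (hA : IsElasticTensor A) :
    ∃ α : ℝ, 0 < α ∧ ∀ e : SymT d, α * ‖e‖ ^ 2 ≤ inner ℝ (A e) e :=
  exists_coercive_of_pos A hA.pos

lemma IsElasticTensor.apply_inverse {A : Tens4 d} (hA : IsElasticTensor A) (s : SymT d) :
    A (A.inverse s) = s := by
  obtain ⟨α, hα, h⟩ := hA.exists_coercive
  exact (inverse_of_coercive hα h).1 s

lemma IsElasticTensor.inverse_apply {A : Tens4 d} (hA : IsElasticTensor A) (e : SymT d) :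
    A.inverse (A e) = e := by
  obtain ⟨α, hα, h⟩ := hA.exists_coercive
  exact (inverse_of_coercive hα h).2.1 e

lemma IsElasticTensor.inverse {A : Tens4 d} (hA : IsElasticTensor A) :
    IsElasticTensor A.inverse where
  symm s s' := by
    conv_lhs => rw [← hA.apply_inverse s', ← hA.symm, hA.apply_inverse]
  pos s hs := by
    have h : A.inverse s ≠ 0 := fun h0 => hs (by rw [← hA.apply_inverse s, h0, map_zero])
    have := hA.pos _ h
    rwa [hA.apply_inverse, real_inner_comm] at this

section Inner

variable {G : Type*} [NormedAddCommGroup G] [InnerProductSpace ℝ G]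

variable (C G) in
/-- The scalar product of `L²_per`. -/
def cellInner : L2per C G →ₗ[ℝ] L2per C G →ₗ[ℝ] ℝ :=
  (innerₗ (Lp G 2 (torusMeasure d))).compl₁₂
    (pullEquiv C G).symm.toLinearMap (pullEquiv C G).symm.toLinearMap

lemma cellInner_pull (u v : Lp G 2 (torusMeasure d)) :
    cellInner C G (pull C u) (pull C v) = inner ℝ u v := by
  simp [cellInner, ← pullEquiv_apply]

lemma cellInner_eq (f g : L2per C G) :
    cellInner C G f g = C.avg fun x => inner ℝ (f x) (g x) := by
  obtain ⟨u, rfl⟩ := pull_surjective C f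
  obtain ⟨v, rfl⟩ := pull_surjective C g
  rw [cellInner_pull, ← setAverage_inner_pull C]
  rfl

lemma cellInner_comm (f g : L2per C G) : cellInner C G f g = cellInner C G g f := by
  obtain ⟨u, rfl⟩ := pull_surjective C f
  obtain ⟨v, rfl⟩ := pull_surjective C g
  rw [cellInner_pull, cellInner_pull, real_inner_comm]

lemma cellInner_self_nonneg (f : L2per C G) : 0 ≤ cellInner C G f f := by
  obtain ⟨u, rfl⟩ := pull_surjective C f
  rw [cellInner_pull]
  exact real_inner_self_nonneg

lemma eq_zero_of_cellInner_self {f : L2per C G} (hf : cellInner C G f f = 0) : f = 0 := by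
  obtain ⟨u, rfl⟩ := pull_surjective C f
  rw [cellInner_pull, inner_self_eq_zero] at hf
  rw [hf, map_zero]

lemma integrable_inner (f g : L2per C G) :
    Integrable (fun x => inner ℝ (f x) (g x)) (volume.restrict C.V) :=
  (L2.integrable_inner (𝕜 := ℝ) ((memLp_cell f).toLp f) ((memLp_cell g).toLp g)).congr
    (by filter_upwards [(memLp_cell f).coeFn_toLp, (memLp_cell g).coeFn_toLp] with x h1 h2
        rw [h1, h2])

/-- Orthogonal projections onto closed subspaces of a Hilbert space exist for coercive forms. -/
lemma exists_mem_forall_inner_map_sub_eq_zero {H : Type*} [NormedAddCommGroup H]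
    [InnerProductSpace ℝ H] [CompleteSpace H] (T : H →L[ℝ] H) {α : ℝ} (hα : 0 < α)
    (hT : ∀ u, α * ‖u‖ ^ 2 ≤ inner ℝ (T u) u) (K : Submodule ℝ H) (hK : IsClosed (K : Set H))
    (u : H) : ∃ p ∈ K, ∀ w ∈ K, inner ℝ (T (u - p)) w = 0 := by
  have : CompleteSpace K := hK.completeSpace_coe
  let B : K →L[ℝ] K →L[ℝ] ℝ := LinearMap.mkContinuous₂
    (LinearMap.mk₂ ℝ (fun v w : K => inner ℝ (T v) (w : H))
      (fun _ _ _ => by simp [inner_add_left]) (fun _ _ _ => by simp [real_inner_smul_left])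
      (fun _ _ _ => by simp [inner_add_right]) (fun _ _ _ => by simp [real_inner_smul_right]))
    ‖T‖ (fun v w => (norm_inner_le_norm _ _).trans
      (mul_le_mul_of_nonneg_right (T.le_opNorm _) (norm_nonneg _)))
  have hB : ∀ v w : K, B v w = inner ℝ (T v) (w : H) := fun v w => rfl
  have hBco : IsCoercive B := ⟨α, hα, fun v => by
    rw [hB, mul_assoc, ← sq]; exact hT v⟩
  -- Lax–Milgram on `K`: the functional `w ↦ ⟪T u, w⟫` is represented in `K` by the ordinary
  -- projection of `T u`. The space thus keeps its L² norm and is not renormed by the energy.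
  let p := hBco.continuousLinearEquivOfBilin.symm (K.orthogonalProjectionOnto (T u))
  have hp : ∀ w : K, inner ℝ (T p) (w : H) = inner ℝ (T u) (w : H) := by
    intro w
    rw [← hB, ← hBco.continuousLinearEquivOfBilin_apply, ContinuousLinearEquiv.apply_symm_apply]
    exact K.inner_orthogonalProjectionOnto_eq_of_mem_right w (T u)
  refine ⟨p, p.2, fun w hw => ?_⟩
  rw [map_sub, inner_sub_left, hp ⟨w, hw⟩, sub_self]

lemma coercive_compLpL {A : G →L[ℝ] G} {α : ℝ} (hA : ∀ e : G, α * ‖e‖ ^ 2 ≤ inner ℝ (A e) e)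
    (u : Lp G 2 (torusMeasure d)) :
    α * ‖u‖ ^ 2 ≤ inner ℝ (A.compLpL 2 (torusMeasure d) u) u := by
  rw [← real_inner_self_eq_norm_sq, L2.inner_def, L2.inner_def, ← integral_const_mul]
  refine integral_mono_ae ((L2.integrable_inner (𝕜 := ℝ) u u).const_mul α)
    (L2.integrable_inner (𝕜 := ℝ) _ u) ?_
  filter_upwards [A.coeFn_compLpL (p := 2) u] with θ h1
  rw [h1, real_inner_self_eq_norm_sq]
  exact hA _

lemma exists_mem_forall_inner_compLpL_eq_zero [CompleteSpace G] {A : G →L[ℝ] G} {α : ℝ}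
    (hα : 0 < α) (hA : ∀ e : G, α * ‖e‖ ^ 2 ≤ inner ℝ (A e) e) (K : Submodule ℝ (L2per C G))
    (hK : IsClosed {u : Lp G 2 (torusMeasure d) | pull C u ∈ K})
    (u : Lp G 2 (torusMeasure d)) :
    ∃ p, pull C p ∈ K ∧ ∀ w, pull C w ∈ K →
      inner ℝ (A.compLpL 2 (torusMeasure d) (u - p)) w = 0 :=
  exists_mem_forall_inner_map_sub_eq_zero _ hα (coercive_compLpL hA) (K.comap (pull C)) hK u

end Inner

variable (C) in
/-- The scalar product of `L²_per` tensor fields. -/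
def tensorInner : L2per C (SymT d) →ₗ[ℝ] L2per C (SymT d) →ₗ[ℝ] ℝ := cellInner C (SymT d)

lemma tensorInner_pull (u v : Lp (SymT d) 2 (torusMeasure d)) :
    tensorInner C (pull C u) (pull C v) = inner ℝ u v := cellInner_pull u v

lemma tensorInner_eq (f g : L2per C (SymT d)) :
    tensorInner C f g = C.avg fun x => inner ℝ (f x) (g x) := cellInner_eq f g

lemma tensorInner_comm (f g : L2per C (SymT d)) : tensorInner C f g = tensorInner C g f :=
  cellInner_comm f g

lemma tensorInner_self_nonneg (f : L2per C (SymT d)) : 0 ≤ tensorInner C f f :=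
  cellInner_self_nonneg f

lemma eq_zero_of_tensorInner_self {f : L2per C (SymT d)} (hf : tensorInner C f f = 0) : f = 0 :=
  eq_zero_of_cellInner_self hf

lemma integrable_tensorInner (f g : L2per C (SymT d)) :
    Integrable (fun x => inner ℝ (f x) (g x)) (volume.restrict C.V) := integrable_inner f g

lemma avg_congr {f g : Pt d → ℝ} (h : f =ᵐ[volume] g) : C.avg f = C.avg g :=
  average_congr (ae_restrict_of_ae h)

lemma coeFn_act (A : BddField C) (f : L2per C (SymT d)) :
    (A.act f : Pt d → SymT d) =ᵐ[volume] fun x => A.toFun x (f x) :=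
  AEEqFun.coeFn_mk _ (A.aestronglyMeasurable_apply f)

/-- The action of a field of fourth-order tensors, as a linear map. -/
def actₗ (A : BddField C) : L2per C (SymT d) →ₗ[ℝ] L2per C (SymT d) where
  toFun := A.act
  map_add' f g := L2per_ext <| by
    filter_upwards [coeFn_act A (f + g), coeFn_act A f, coeFn_act A g,
      AEEqFun.coeFn_add (f : Pt d →ₘ[volume] SymT d) (g : Pt d →ₘ[volume] SymT d),
      AEEqFun.coeFn_add (A.act f : Pt d →ₘ[volume] SymT d) (A.act g : Pt d →ₘ[volume] SymT d)]
      with x h1 h2 h3 h4 h5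
    rw [h1, Submodule.coe_add, Submodule.coe_add, h4, h5, Pi.add_apply, Pi.add_apply, map_add,
      h2, h3]
  map_smul' c f := L2per_ext <| by
    filter_upwards [coeFn_act A (c • f), coeFn_act A f,
      AEEqFun.coeFn_smul c (f : Pt d →ₘ[volume] SymT d),
      AEEqFun.coeFn_smul c (A.act f : Pt d →ₘ[volume] SymT d)] with x h1 h2 h3 h4
    rw [h1, RingHom.id_apply, Submodule.coe_smul, Submodule.coe_smul, h3, h4, Pi.smul_apply,
      Pi.smul_apply, map_smul, h2]

lemma actₗ_apply (A : BddField C) (f : L2per C (SymT d)) : actₗ A f = A.act f := rfl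

lemma tensorInner_act_comm {A : BddField C}
    (hA : ∀ᵐ x : Pt d, ∀ e e' : SymT d, inner ℝ (A.toFun x e) e' = inner ℝ e (A.toFun x e'))
    (f g : L2per C (SymT d)) : tensorInner C (actₗ A f) g = tensorInner C f (actₗ A g) := by
  rw [tensorInner_eq, tensorInner_eq]
  refine avg_congr ?_
  filter_upwards [hA, coeFn_act A f, coeFn_act A g] with x h h1 h2
  rw [actₗ_apply, actₗ_apply, h1, h2, h]

lemma actₗ_const_inverse {A : Tens4 d} (hA : IsElasticTensor A) (f : L2per C (SymT d)) :
    actₗ (BddField.const C A.inverse) (actₗ (BddField.const C A) f) = f := by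
  refine L2per_ext ?_
  filter_upwards [coeFn_act (BddField.const C A.inverse) (actₗ (BddField.const C A) f),
    coeFn_act (BddField.const C A) f] with x h1 h2
  rw [actₗ_apply, h1, actₗ_apply, h2]
  exact hA.inverse_apply _

lemma actₗ_const_apply_inverse {A : Tens4 d} (hA : IsElasticTensor A) (f : L2per C (SymT d)) :
    actₗ (BddField.const C A) (actₗ (BddField.const C A.inverse) f) = f := by
  refine L2per_ext ?_
  filter_upwards [coeFn_act (BddField.const C A) (actₗ (BddField.const C A.inverse) f),
    coeFn_act (BddField.const C A.inverse) f] with x h1 h2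
  rw [actₗ_apply, h1, actₗ_apply, h2]
  exact hA.apply_inverse _

variable (C) in
/-- The energetic scalar product, as a bilinear form. -/
def energyForm (A : Tens4 d) : L2per C (SymT d) →ₗ[ℝ] L2per C (SymT d) →ₗ[ℝ] ℝ :=
  (tensorInner C).comp (actₗ (BddField.const C A))

lemma energyForm_apply (A : Tens4 d) (f g : L2per C (SymT d)) :
    energyForm C A f g = tensorInner C (actₗ (BddField.const C A) f) g := rfl

lemma scalarE_eq (A : Tens4 d) (f g : L2per C (SymT d)) :
    scalarE C A f g = energyForm C A f g := by
  rw [energyForm_apply, tensorInner_eq]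
  refine avg_congr ?_
  filter_upwards [coeFn_act (BddField.const C A) f] with x h
  rw [actₗ_apply, h]
  rfl

/-- Brings both spaces under one family of forms: facts on `energyForm` serve H_e with `L₀` and H_s
with its inverse. -/
lemma scalarS_eq {A : Tens4 d} (hA : IsElasticTensor A) (f g : L2per C (SymT d)) :
    scalarS C A f g = energyForm C A.inverse f g := by
  rw [← scalarE_eq]
  exact avg_congr (Filter.Eventually.of_forall fun x => (hA.inverse.symm _ _).symm)

lemma energyForm_comm {A : Tens4 d} (hA : IsElasticTensor A) (f g : L2per C (SymT d)) :
    energyForm C A f g = energyForm C A g f := by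
  rw [energyForm_apply, energyForm_apply,
    tensorInner_act_comm (A := BddField.const C A) (Filter.Eventually.of_forall fun x => hA.symm), tensorInner_comm]

lemma pull_compLpL (A : Tens4 d) (u : Lp (SymT d) 2 (torusMeasure d)) :
    pull C (A.compLpL 2 (torusMeasure d) u) = actₗ (BddField.const C A) (pull C u) := by
  refine L2per_ext ?_
  filter_upwards [coeFn_pull C (A.compLpL 2 (torusMeasure d) u), coeFn_pull C u,
    coeFn_act (BddField.const C A) (pull C u),
    C.quasiMeasurePreserving_toTorus.ae_eq_comp (A.coeFn_compLpL (p := 2) u)] with x h1 h2 h3 h4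
  rw [h1, h4, actₗ_apply, h3, h2]
  rfl

lemma energyForm_pull (A : Tens4 d) (u v : Lp (SymT d) 2 (torusMeasure d)) :
    energyForm C A (pull C u) (pull C v) = inner ℝ (A.compLpL 2 (torusMeasure d) u) v := by
  rw [energyForm_apply, ← pull_compLpL, tensorInner_pull]

lemma le_energyForm_self {A : Tens4 d} {α : ℝ} (h : ∀ e : SymT d, α * ‖e‖ ^ 2 ≤ inner ℝ (A e) e)
    (f : L2per C (SymT d)) : α * tensorInner C f f ≤ energyForm C A f f := by
  obtain ⟨u, rfl⟩ := pull_surjective C f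
  rw [energyForm_pull, tensorInner_pull]
  exact (congrArg _ (real_inner_self_eq_norm_sq u)).trans_le (coercive_compLpL h u)

lemma energyForm_self_nonneg {A : Tens4 d} (hA : IsElasticTensor A) (f : L2per C (SymT d)) :
    0 ≤ energyForm C A f f := by
  obtain ⟨α, hα, h⟩ := hA.exists_coercive
  exact (mul_nonneg hα.le (tensorInner_self_nonneg f)).trans (le_energyForm_self h f)

lemma eq_zero_of_energyForm_self {A : Tens4 d} (hA : IsElasticTensor A) {f : L2per C (SymT d)}
    (hf : energyForm C A f f = 0) : f = 0 := by
  obtain ⟨α, hα, h⟩ := hA.exists_coercive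
  have h1 := le_energyForm_self h f
  rw [hf] at h1
  exact eq_zero_of_tensorInner_self
    (le_antisymm (nonpos_of_mul_nonpos_right h1 hα) (tensorInner_self_nonneg f))

/-- Orthogonal projections onto closed subspaces exist for the energetic scalar products. -/
lemma exists_isOrthProj_energyForm {A : Tens4 d} (hA : IsElasticTensor A)
    (K : Submodule ℝ (L2per C (SymT d)))
    (hK : IsClosed {u : Lp (SymT d) 2 (torusMeasure d) | pull C u ∈ K})
    (h : L2per C (SymT d)) :
    ∃ p, IsOrthProj (fun f g => energyForm C A f g) (K : Set (L2per C (SymT d))) h p := by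
  obtain ⟨α, hα, hco⟩ := hA.exists_coercive
  obtain ⟨u, rfl⟩ := pull_surjective C h
  obtain ⟨p, hp, hw⟩ := exists_mem_forall_inner_compLpL_eq_zero hα hco K hK u
  refine ⟨pull C p, hp, fun k hk => ?_⟩
  obtain ⟨w, rfl⟩ := pull_surjective C k
  rw [← map_sub]
  exact (energyForm_pull A (u - p) w).trans (hw w hk)

end

end Homogenization

/-! ### Abstract quadratic expansions and orthogonal projections. -/

namespace Homogenization

noncomputable section

lemma eq_add_add_of_eq {a a' b b' u v : ℝ} (ha : a = a') (hb : b = b') (h : a' = b' + u + v) :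
    a = b + u + v := by
  rw [ha, hb, h]

lemma add_expansions {a a' b b' c u v w p q t : ℝ} (ha : a' = a + t * u + t ^ 2 * p)
    (hb : b' = b + t * v + t ^ 2 * q) (h : w = u + v) :
    c + a' + b' = c + a + b + t * w + t ^ 2 * (p + q) := by
  rw [ha, hb, h]; ring

lemma add_expansions' {a a' b b' c u v w p q t : ℝ} (ha : a' = a + t * u + t ^ 2 * p)
    (hb : b' = b + t * v + t ^ 2 * q) (h : w = u + v) :
    b' + a' + c = b + a + c + t * w + t ^ 2 * (p + q) := by
  rw [ha, hb, h]; ring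

section Abstract

variable {H : Type*} [AddCommGroup H] [Module ℝ H]

/-- The difference quotient is exactly `B g₀ k + t * b k`. Uniqueness follows from the direction `k
= g - g₀` and definiteness. -/
lemma isGradientFor_iff {B : H →ₗ[ℝ] H →ₗ[ℝ] ℝ} (hB : ∀ x, B x x = 0 → x = 0) {J : H → ℝ}
    {h g₀ : H} {b : H → ℝ}
    (hJ : ∀ (k : H) (t : ℝ), J (h + t • k) = J h + t * B g₀ k + t ^ 2 * b k) (g : H) :
    IsGradientFor (fun f k => B f k) J h g ↔ g = g₀ := by
  have hlim : ∀ k, Filter.Tendsto (fun t : ℝ => (J (h + t • k) - J h) / t)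
      (nhdsWithin 0 {0}ᶜ) (nhds (B g₀ k)) := by
    intro k
    have h1 : Filter.Tendsto (fun t : ℝ => B g₀ k + t * b k) (nhdsWithin 0 {0}ᶜ)
        (nhds (B g₀ k)) := by
      have : Continuous fun t : ℝ => B g₀ k + t * b k := by fun_prop
      simpa using (this.tendsto 0).mono_left nhdsWithin_le_nhds
    refine h1.congr' ?_
    filter_upwards [self_mem_nhdsWithin] with t ht
    have ht : t ≠ 0 := ht
    rw [hJ]
    field_simp
    ring
  constructor
  · intro hg
    rw [← sub_eq_zero]
    refine hB _ ?_
    rw [LinearMap.map_sub₂, sub_eq_zero]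
    exact tendsto_nhds_unique (hg _) (hlim _)
  · rintro rfl
    exact hlim

lemma orthProj_isOrthProj {H : Type*} [AddCommGroup H] {ps : H → H → ℝ} {K : Set H} {h : H}
    (hp : ∃ p, IsOrthProj ps K h p) :
    IsOrthProj ps K h (orthProj ps K h) := by
  unfold orthProj
  rw [dif_pos hp]
  exact hp.choose_spec

lemma IsOrthProj.unique {B : H →ₗ[ℝ] H →ₗ[ℝ] ℝ} (hB : ∀ x, B x x = 0 → x = 0)
    {K : Submodule ℝ H} {h p p' : H} (hp : IsOrthProj (fun f g => B f g) (K : Set H) h p)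
    (hp' : IsOrthProj (fun f g => B f g) (K : Set H) h p') : p = p' := by
  have hmem : p - p' ∈ K := K.sub_mem hp.1 hp'.1
  have h1 := hp.2 _ hmem
  have h2 := hp'.2 _ hmem
  rw [← sub_eq_zero]
  refine hB _ ?_
  have h3 : p - p' = (h - p') - (h - p) := by abel
  simp only at h1 h2
  nth_rw 1 [h3]
  rw [LinearMap.map_sub₂, h1, h2, sub_zero]

/-- `orthProj` is defined by choice; with `IsOrthProj.unique`, this makes it linear. -/
lemma IsOrthProj.add_smul {B : H →ₗ[ℝ] H →ₗ[ℝ] ℝ} {K : Submodule ℝ H} {h h' p p' : H}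
    (hp : IsOrthProj (fun f g => B f g) (K : Set H) h p)
    (hp' : IsOrthProj (fun f g => B f g) (K : Set H) h' p') (t : ℝ) :
    IsOrthProj (fun f g => B f g) (K : Set H) (h + t • h') (p + t • p') := by
  refine ⟨K.add_mem hp.1 (K.smul_mem t hp'.1), fun k hk => ?_⟩
  have h1 := hp.2 k hk
  have h2 := hp'.2 k hk
  have h3 : h + t • h' - (p + t • p') = (h - p) + t • (h' - p') := by rw [smul_sub]; abel
  simp only at h1 h2 ⊢
  rw [h3, map_add, map_smul, LinearMap.add_apply, LinearMap.smul_apply, h1, h2]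
  simp

lemma bilin_add_smul_self {B : H →ₗ[ℝ] H →ₗ[ℝ] ℝ} (hB : ∀ x y, B x y = B y x) (x y : H) (t : ℝ) :
    B (x + t • y) (x + t • y) = B x x + t * (2 * B x y) + t ^ 2 * B y y := by
  simp only [map_add, map_smul, LinearMap.add_apply, LinearMap.smul_apply, smul_eq_mul, hB y x]
  ring

/-- Models the constitutive error as one field varies; `c` collects the energy of the other field.
-/
lemma quadratic_sub_linear_add_smul {B : H →ₗ[ℝ] H →ₗ[ℝ] ℝ} (hB : ∀ x y, B x y = B y x)
    {T : H →ₗ[ℝ] H} (hT : ∀ x y, B (T x) y = B x (T y)) (c : ℝ) (z x y : H) (t : ℝ) :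
    1 / 2 * B (T (x + t • y)) (x + t • y) + c - B z (x + t • y) =
      1 / 2 * B (T x) x + c - B z x + t * B (T x - z) y + t ^ 2 * (1 / 2 * B (T y) y) := by
  have h : B (T y) x = B (T x) y := by rw [hT, hB]
  simp only [map_add, map_sub, map_smul, LinearMap.add_apply, LinearMap.sub_apply,
    LinearMap.smul_apply, smul_eq_mul, h]
  ring

/-- Since `y - q` is orthogonal to `p ∈ K`, `B p q = B p y`: half the squared norm of a projection
has that projection as gradient. -/
lemma IsOrthProj.half_sq_add_smul {B : H →ₗ[ℝ] H →ₗ[ℝ] ℝ} (hB : ∀ x y, B x y = B y x)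
    {K : Submodule ℝ H} {x y p q : H} (hp : IsOrthProj (fun f g => B f g) (K : Set H) x p)
    (hq : IsOrthProj (fun f g => B f g) (K : Set H) y q) (t : ℝ) :
    1 / 2 * B (p + t • q) (p + t • q) =
      1 / 2 * B p p + t * B p y + t ^ 2 * (1 / 2 * B q q) := by
  have h : B (y - q) p = 0 := hq.2 p hp.1
  rw [hB, map_sub, sub_eq_zero] at h
  rw [bilin_add_smul_self hB, h]
  ring

/-- Both `x - p` and `z` are orthogonal to `q ∈ K`, so `y - q` may be replaced by `y` in the linear
term. Here `z` stands for the uniform mean strain. -/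
lemma IsOrthProj.half_sq_sub_add_smul {B : H →ₗ[ℝ] H →ₗ[ℝ] ℝ} (hB : ∀ x y, B x y = B y x)
    {K : Submodule ℝ H} {x y p q z : H} (hp : IsOrthProj (fun f g => B f g) (K : Set H) x p)
    (hq : IsOrthProj (fun f g => B f g) (K : Set H) y q) (hz : ∀ k ∈ K, B z k = 0) (t : ℝ) :
    1 / 2 * B (x + t • y - (p + t • q) - z) (x + t • y - (p + t • q) - z) =
      1 / 2 * B (x - p - z) (x - p - z) + t * B (x - p - z) y +
        t ^ 2 * (1 / 2 * B (y - q) (y - q)) := by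
  have h1 : B (x - p) q = 0 := hp.2 q hq.1
  have h2 : x + t • y - (p + t • q) - z = (x - p - z) + t • (y - q) := by rw [smul_sub]; abel
  have h3 : B (x - p - z) (y - q) = B (x - p - z) y := by
    rw [map_sub (B (x - p - z)), sub_eq_self, LinearMap.map_sub₂, h1, hz q hq.1, sub_zero]
  rw [h2, bilin_add_smul_self hB, h3]
  ring

end Abstract

/-! ### Expansion of the three terms of the functional. -/

variable {d : ℕ} {C : UnitCell d}

variable (C) in
/-- The compatible strain fields, as a subspace. -/
def compatibleSubmodule : Submodule ℝ (L2per C (SymT d)) :=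
  (⨅ k, (LinearMap.range (symGradCoef (C.freq k))).comap
    (tensorCoef k : Lp (SymT d) 2 (torusMeasure d) →ₗ[ℝ] (Fin d → Fin d → ℂ))).map (pull C)

-- The linear structure of E₀ comes from the Fourier characterization, not from adding weak
-- derivatives.
variable (C) in
lemma coe_compatibleSubmodule : (compatibleSubmodule C : Set (L2per C (SymT d))) =
    compatibleStrains C := by
  ext f
  obtain ⟨u, rfl⟩ := pull_surjective C f
  simp only [compatibleSubmodule, Submodule.map_coe, Set.mem_image, SetLike.mem_coe,
    Submodule.mem_iInf, Submodule.mem_comap]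
  constructor
  · rintro ⟨v, hv, hvu⟩
    rw [← hvu]
    exact mem_compatibleStrains_of_tensorCoef_mem hv
  · exact fun h => ⟨u, tensorCoef_mem_of_mem_compatibleStrains h, rfl⟩

/-- The orthogonal of a set of fields, as a subspace. -/
def orthogonalSubmodule (A : Tens4 d) (K : Set (L2per C (SymT d))) :
    Submodule ℝ (L2per C (SymT d)) where
  carrier := orthogonalFor (fun f g => energyForm C A f g) K
  zero_mem' k _ := by simp
  add_mem' {f g} hf hg k hk := by
    have h1 := hf k hk
    have h2 := hg k hk
    simp only at h1 h2 ⊢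
    rw [map_add, LinearMap.add_apply, h1, h2, add_zero]
  smul_mem' c f hf k hk := by
    have h1 := hf k hk
    simp only at h1 ⊢
    rw [map_smul, LinearMap.smul_apply, h1, smul_zero]

lemma continuous_inner_compLpL {G : Type*} [NormedAddCommGroup G] [InnerProductSpace ℝ G]
    (A : G →L[ℝ] G) (w : Lp G 2 (torusMeasure d)) :
    Continuous fun u : Lp G 2 (torusMeasure d) => inner ℝ (A.compLpL 2 (torusMeasure d) u) w :=
  (A.compLpL 2 (torusMeasure d)).continuous.inner continuous_const

/-- An intersection of kernels of continuous functionals; `K` is any set, so nothing about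
admissible stresses enters. -/
lemma isClosed_orthogonalSubmodule (A : Tens4 d) (K : Set (L2per C (SymT d))) :
    IsClosed {u : Lp (SymT d) 2 (torusMeasure d) | pull C u ∈ orthogonalSubmodule A K} := by
  have h : {u : Lp (SymT d) 2 (torusMeasure d) | pull C u ∈ orthogonalSubmodule A K} =
      ⋂ k ∈ K, {u | energyForm C A (pull C u) k = 0} := by
    ext u
    simp only [Set.mem_iInter]
    rfl
  rw [h]
  refine isClosed_biInter fun k _ => ?_
  obtain ⟨w, rfl⟩ := pull_surjective C k
  simp_rw [energyForm_pull]
  exact isClosed_singleton.preimage (continuous_inner_compLpL A w)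

lemma isOrthProj_projE₀ {L₀ : Tens4 d} (hL₀ : IsElasticTensor L₀) (η : StrainField C) :
    IsOrthProj (fun f g => energyForm C L₀ f g) (compatibleSubmodule C : Set (L2per C (SymT d))) η
      (projE₀ C L₀ η) := by
  have h := exists_isOrthProj_energyForm hL₀ (compatibleSubmodule C) (by
    simp_rw [← SetLike.mem_coe, coe_compatibleSubmodule]
    exact isClosed_compatibleStrains C) η
  have e : scalarE C L₀ = fun f g => energyForm C L₀ f g := funext₂ fun f g => scalarE_eq L₀ f g
  rw [projE₀, e, ← coe_compatibleSubmodule]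
  exact orthProj_isOrthProj h

lemma isOrthProj_projSperp {L₀ : Tens4 d} (hL₀ : IsElasticTensor L₀) (τ : StressField C) :
    IsOrthProj (fun f g => energyForm C L₀.inverse f g)
      (orthogonalSubmodule L₀.inverse (admissibleStresses C) : Set (L2per C (SymT d))) τ
      (projSperp C L₀ τ) := by
  have h := exists_isOrthProj_energyForm hL₀.inverse
    (orthogonalSubmodule L₀.inverse (admissibleStresses C)) (isClosed_orthogonalSubmodule _ _) τ
  have e : scalarS C L₀ = fun f g => energyForm C L₀.inverse f g :=
    funext₂ fun f g => scalarS_eq hL₀ f g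
  rw [projSperp, stressesPerp, e]
  exact orthProj_isOrthProj h

lemma coeFn_uniform (e : SymT d) : (uniform C e : Pt d → SymT d) =ᵐ[volume] fun _ => e :=
  AEEqFun.coeFn_const (α := Pt d) (μ := volume) e

/-- The weak derivatives of periodic functions have zero mean. -/
lemma IsWeakPartial.setIntegral_eq_zero {j : Fin d} {f g : L2per C ℝ}
    (h : IsWeakPartial C j f g) : ∫ x in C.V, g x = 0 := by
  -- The constant test function has zero derivative.
  have h1 := h (fun _ => 1) ⟨contDiff_const, fun _ _ _ => rfl⟩
  simpa [partialDeriv] using h1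

/-- Uniform fields are orthogonal to compatible strain fields. -/
lemma tensorInner_uniform {e : SymT d} {f : StrainField C} (hf : f ∈ compatibleStrains C) :
    tensorInner C (uniform C e) f = 0 := by
  obtain ⟨w, G, hw, hG⟩ := hf
  rw [tensorInner_eq]
  have h1 : (fun x => inner ℝ (uniform C e x) (f x)) =ᵐ[volume]
      fun x => ∑ i, ∑ j, (e : Tens2 d) (i, j) * (1 / 2 * (G i j x + G j i x)) := by
    filter_upwards [hG, coeFn_uniform (C := C) e] with x h2 h3
    rw [h3, inner_symT]
    simp_rw [h2]
  have hint : ∀ i j, Integrable (G i j) (volume.restrict C.V) := fun i j =>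
    (memLp_cell (G i j)).integrable (by simp)
  have hint2 : ∀ i j, Integrable (fun x => (e : Tens2 d) (i, j) * (1 / 2 * (G i j x + G j i x)))
      (volume.restrict C.V) := fun i j =>
    (((hint i j).add (hint j i)).const_mul (1 / 2)).const_mul _
  rw [avg_congr h1, UnitCell.avg, setAverage_eq,
    integral_finsetSum _ fun i _ => integrable_finsetSum _ fun j _ => hint2 i j]
  rw [Finset.sum_eq_zero, smul_zero]
  intro i _
  rw [integral_finsetSum _ fun j _ => hint2 i j]
  refine Finset.sum_eq_zero fun j _ => ?_
  rw [integral_const_mul, integral_const_mul, integral_add (hint i j) (hint j i),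
    (hw i j).setIntegral_eq_zero, (hw j i).setIntegral_eq_zero]
  simp

lemma ElasticField.inv_symm (L : ElasticField C) : ∀ᵐ x : Pt d, ∀ s s' : SymT d,
    inner ℝ (L.inv.toFun x s) s' = inner ℝ s (L.inv.toFun x s') := by
  obtain ⟨α, hα, hco⟩ := L.coercive
  filter_upwards [L.symm, hco] with x hs hc s s'
  have hi := (inverse_of_coercive hα hc).1
  change inner ℝ ((L.toFun x).inverse s) s' = inner ℝ s ((L.toFun x).inverse s')
  conv_lhs => rw [← hi s', ← hs, hi]

lemma avg_linearCombination {f g h : Pt d → ℝ} (hf : Integrable f (volume.restrict C.V))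
    (hg : Integrable g (volume.restrict C.V)) (hh : Integrable h (volume.restrict C.V)) (a b : ℝ) :
    C.avg (fun x => a * f x + b * g x - h x) = a * C.avg f + b * C.avg g - C.avg h := by
  simp only [UnitCell.avg, setAverage_eq, smul_eq_mul]
  rw [integral_sub (f := fun x => a * f x + b * g x) ((hf.const_mul a).add (hg.const_mul b)) hh,
    integral_add (hf.const_mul a) (hg.const_mul b), integral_const_mul, integral_const_mul]
  ring

lemma constitutiveError_ae_eq (L : ElasticField C) (τ : StressField C) (η : StrainField C) :
    constitutiveError L τ η =ᵐ[volume] fun x =>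
      1 / 2 * inner ℝ (actₗ L.toBddField η x) (η x) + 1 / 2 * inner ℝ (τ x) (actₗ L.inv τ x)
        - inner ℝ (τ x) (η x) := by
  filter_upwards [coeFn_act L.toBddField η, coeFn_act L.inv τ] with x h2 h3
  simp only [actₗ_apply]
  rw [h2, h3]
  rfl

lemma deltaConst_eq (L : ElasticField C) (τ : StressField C) (η : StrainField C) :
    deltaConst L τ η = 1 / 2 * tensorInner C (actₗ L.toBddField η) η
      + 1 / 2 * tensorInner C τ (actₗ L.inv τ) - tensorInner C τ η :=
  (avg_congr (constitutiveError_ae_eq L τ η)).trans <|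
    (avg_linearCombination (integrable_tensorInner _ _) (integrable_tensorInner _ _)
      (integrable_tensorInner _ _) _ _).trans (by
        rw [tensorInner_eq, tensorInner_eq, tensorInner_eq])

/-- Exchanges the roles of stress and strain, so that `quadratic_sub_linear_add_smul` also handles
variations of `τ`. -/
lemma deltaConst_eq_comm (L : ElasticField C) (τ : StressField C) (η : StrainField C) :
    deltaConst L τ η = 1 / 2 * tensorInner C (actₗ L.inv τ) τ
      + 1 / 2 * tensorInner C (actₗ L.toBddField η) η - tensorInner C η τ :=
  (deltaConst_eq L τ η).trans <| congrArg₂ (· - ·)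
    ((add_comm _ _).trans <| congrArg (1 / 2 * · + _) (tensorInner_comm τ (actₗ L.inv τ)))
    (tensorInner_comm τ η)

lemma deltaConst_add_smul_right (L : ElasticField C) (τ : StressField C) (η κ : StrainField C)
    (t : ℝ) : deltaConst L τ (η + t • κ) = deltaConst L τ η
      + t * tensorInner C (actₗ L.toBddField η - τ) κ
      + t ^ 2 * (1 / 2 * tensorInner C (actₗ L.toBddField κ) κ) :=
  eq_add_add_of_eq (deltaConst_eq L τ (η + t • κ)) (deltaConst_eq L τ η)
    (quadratic_sub_linear_add_smul (B := tensorInner C) tensorInner_comm (T := actₗ L.toBddField)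
      (tensorInner_act_comm (A := L.toBddField) L.symm)
      (1 / 2 * tensorInner C τ (actₗ L.inv τ)) τ η κ t)

lemma deltaConst_add_smul_left (L : ElasticField C) (τ σ : StressField C) (η : StrainField C)
    (t : ℝ) : deltaConst L (τ + t • σ) η = deltaConst L τ η
      + t * tensorInner C (actₗ L.inv τ - η) σ
      + t ^ 2 * (1 / 2 * tensorInner C (actₗ L.inv σ) σ) :=
  eq_add_add_of_eq (deltaConst_eq_comm L (τ + t • σ) η) (deltaConst_eq_comm L τ η)
    (quadratic_sub_linear_add_smul (B := tensorInner C) tensorInner_comm (T := actₗ L.inv)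
      (tensorInner_act_comm (A := L.inv) L.inv_symm)
      (1 / 2 * tensorInner C (actₗ L.toBddField η) η) η τ σ t)

lemma deltaCompat_eq {L₀ : Tens4 d} (hL₀ : IsElasticTensor L₀) (εbar : SymT d)
    (η : StrainField C) : deltaCompat C L₀ εbar η =
      1 / 2 * energyForm C L₀ (η - projE₀ C L₀ η - uniform C εbar)
        (η - projE₀ C L₀ η - uniform C εbar) := by
  rw [deltaCompat, normE, scalarE_eq, Real.sq_sqrt (energyForm_self_nonneg hL₀ _)]

lemma deltaEquil_eq {L₀ : Tens4 d} (hL₀ : IsElasticTensor L₀) (τ : StressField C) :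
    deltaEquil C L₀ τ =
      1 / 2 * energyForm C L₀.inverse (projSperp C L₀ τ) (projSperp C L₀ τ) := by
  rw [deltaEquil, normS, scalarS_eq hL₀, Real.sq_sqrt (energyForm_self_nonneg hL₀.inverse _)]

lemma projE₀_add_smul {L₀ : Tens4 d} (hL₀ : IsElasticTensor L₀) (η κ : StrainField C) (t : ℝ) :
    projE₀ C L₀ (η + t • κ) = projE₀ C L₀ η + t • projE₀ C L₀ κ :=
  IsOrthProj.unique (fun _ => eq_zero_of_energyForm_self hL₀) (isOrthProj_projE₀ hL₀ _)
    ((isOrthProj_projE₀ hL₀ η).add_smul (isOrthProj_projE₀ hL₀ κ) t)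

lemma projSperp_add_smul {L₀ : Tens4 d} (hL₀ : IsElasticTensor L₀) (τ σ : StressField C) (t : ℝ) :
    projSperp C L₀ (τ + t • σ) = projSperp C L₀ τ + t • projSperp C L₀ σ :=
  IsOrthProj.unique (fun _ => eq_zero_of_energyForm_self hL₀.inverse)
    (isOrthProj_projSperp hL₀ _)
    ((isOrthProj_projSperp hL₀ τ).add_smul (isOrthProj_projSperp hL₀ σ) t)

lemma actₗ_const_uniform (A : Tens4 d) (e : SymT d) :
    actₗ (BddField.const C A) (uniform C e) = uniform C (A e) := L2per_ext <| by
  filter_upwards [coeFn_act (BddField.const C A) (uniform C e), coeFn_uniform (C := C) e,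
    coeFn_uniform (C := C) (A e)] with x h1 h2 h3
  rw [actₗ_apply, h1, h2, h3]
  rfl

/-- A constant tensor maps uniform fields to uniform fields, so L² orthogonality to compatible
strains becomes energetic orthogonality. -/
lemma energyForm_uniform (A : Tens4 d) (e : SymT d) {f : L2per C (SymT d)}
    (hf : f ∈ compatibleSubmodule C) : energyForm C A (uniform C e) f = 0 := by
  rw [energyForm_apply, actₗ_const_uniform]
  exact tensorInner_uniform ((coe_compatibleSubmodule C).le hf)

lemma deltaCompat_add_smul {L₀ : Tens4 d} (hL₀ : IsElasticTensor L₀) (εbar : SymT d)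
    (η κ : StrainField C) (t : ℝ) : deltaCompat C L₀ εbar (η + t • κ) = deltaCompat C L₀ εbar η
      + t * energyForm C L₀ (η - projE₀ C L₀ η - uniform C εbar) κ
      + t ^ 2 * (1 / 2 * energyForm C L₀ (κ - projE₀ C L₀ κ) (κ - projE₀ C L₀ κ)) :=
  eq_add_add_of_eq ((deltaCompat_eq hL₀ εbar (η + t • κ)).trans <|
      congrArg (fun p => 1 / 2 * energyForm C L₀ (η + t • κ - p - uniform C εbar)
        (η + t • κ - p - uniform C εbar)) (projE₀_add_smul hL₀ η κ t))
    (deltaCompat_eq hL₀ εbar η)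
    ((isOrthProj_projE₀ hL₀ η).half_sq_sub_add_smul (energyForm_comm hL₀)
      (isOrthProj_projE₀ hL₀ κ) (fun _ => energyForm_uniform L₀ εbar) t)

lemma deltaEquil_add_smul {L₀ : Tens4 d} (hL₀ : IsElasticTensor L₀) (τ σ : StressField C) (t : ℝ) :
    deltaEquil C L₀ (τ + t • σ) = deltaEquil C L₀ τ
      + t * energyForm C L₀.inverse (projSperp C L₀ τ) σ
      + t ^ 2 * (1 / 2 * energyForm C L₀.inverse (projSperp C L₀ σ) (projSperp C L₀ σ)) := by
  rw [deltaEquil_eq hL₀, deltaEquil_eq hL₀, projSperp_add_smul hL₀]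
  exact (isOrthProj_projSperp hL₀ τ).half_sq_add_smul (energyForm_comm hL₀.inverse)
    (isOrthProj_projSperp hL₀ σ) t

/-- Represents an L² pairing in H_s: the origin of the factor `L₀` in the stress gradient. -/
lemma energyForm_inverse_act {L₀ : Tens4 d} (hL₀ : IsElasticTensor L₀) (f σ : L2per C (SymT d)) :
    energyForm C L₀.inverse ((BddField.const C L₀).act f) σ = tensorInner C f σ :=
  (energyForm_apply L₀.inverse _ σ).trans <|
    congrArg (fun z => tensorInner C z σ) (actₗ_const_inverse hL₀ f)

lemma energyForm_act_inverse {L₀ : Tens4 d} (hL₀ : IsElasticTensor L₀) (f σ : L2per C (SymT d)) :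
    energyForm C L₀ ((BddField.const C L₀.inverse).act f) σ = tensorInner C f σ :=
  (energyForm_apply L₀ _ σ).trans <|
    congrArg (fun z => tensorInner C z σ) (actₗ_const_apply_inverse hL₀ f)

lemma functionalP_add_smul_left {L₀ : Tens4 d} (hL₀ : IsElasticTensor L₀) (L : ElasticField C)
    (εbar : SymT d) (τ σ : StressField C) (η : StrainField C) (t : ℝ) :
    functionalP L₀ L εbar (τ + t • σ) η = functionalP L₀ L εbar τ η
      + t * energyForm C L₀.inverse
        ((BddField.const C L₀).act (L.inv.act τ - η) + projSperp C L₀ τ) σ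
      + t ^ 2 * (1 / 2 * tensorInner C (actₗ L.inv σ) σ +
        1 / 2 * energyForm C L₀.inverse (projSperp C L₀ σ) (projSperp C L₀ σ)) :=
  add_expansions (deltaConst_add_smul_left L τ σ η t) (deltaEquil_add_smul hL₀ τ σ t)
    ((LinearMap.map_add₂ (energyForm C L₀.inverse) _ _ σ).trans <|
      congrArg (· + _) (energyForm_inverse_act hL₀ _ σ))

lemma functionalP_add_smul_right {L₀ : Tens4 d} (hL₀ : IsElasticTensor L₀) (L : ElasticField C)
    (εbar : SymT d) (τ : StressField C) (η κ : StrainField C) (t : ℝ) :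
    functionalP L₀ L εbar τ (η + t • κ) = functionalP L₀ L εbar τ η
      + t * energyForm C L₀ ((BddField.const C L₀.inverse).act (L.toBddField.act η - τ)
        + (η - projE₀ C L₀ η - uniform C εbar)) κ
      + t ^ 2 * (1 / 2 * tensorInner C (actₗ L.toBddField κ) κ +
        1 / 2 * energyForm C L₀ (κ - projE₀ C L₀ κ) (κ - projE₀ C L₀ κ)) :=
  add_expansions' (deltaConst_add_smul_right L τ η κ t) (deltaCompat_add_smul hL₀ εbar η κ t)
    ((LinearMap.map_add₂ (energyForm C L₀) _ _ κ).trans <|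
      congrArg (· + _) (energyForm_act_inverse hL₀ _ κ))

end

end Homogenization

/-! ### The proposition. -/

open Homogenization
theorem proposition3p3 {d : ℕ} (C : UnitCell d) (L₀ : Tens4 d) (hL₀ : IsElasticTensor L₀)
    (L : ElasticField C) (εbar : SymT d) :
    -- the orthogonal projections that enter the functional exist
    (∀ η : StrainField C, IsOrthProj (scalarE C L₀) (compatibleStrains C) η (projE₀ C L₀ η)) ∧
    (∀ τ : StressField C, IsOrthProj (scalarS C L₀) (stressesPerp C L₀) τ (projSperp C L₀ τ)) ∧
    -- the partial gradients exist, are unique, and are given by the formulas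
    ∀ (τ : StressField C) (η : StrainField C),
      (∀ g : StressField C,
        IsGradientFor (scalarS C L₀) (fun τ' => functionalP L₀ L εbar τ' η) τ g ↔
          g = (BddField.const C L₀).act (L.inv.act τ - η) + projSperp C L₀ τ) ∧
      (∀ g : StrainField C,
        IsGradientFor (scalarE C L₀) (fun η' => functionalP L₀ L εbar τ η') η g ↔
          g = (BddField.const C L₀.inverse).act (L.toBddField.act η - τ)
            + (η - projE₀ C L₀ η) - uniform C εbar) := by
  have eE : scalarE C L₀ = fun f g => energyForm C L₀ f g := funext₂ fun f g => scalarE_eq L₀ f g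
  have eS : scalarS C L₀ = fun f g => energyForm C L₀.inverse f g :=
    funext₂ fun f g => scalarS_eq hL₀ f g
  refine ⟨fun η => ?_, fun τ => ?_, fun τ η => ⟨fun g => ?_, fun g => ?_⟩⟩
  · rw [eE, ← coe_compatibleSubmodule]
    exact isOrthProj_projE₀ hL₀ η
  · rw [stressesPerp, eS]
    exact isOrthProj_projSperp hL₀ τ
  · rw [eS]
    exact isGradientFor_iff (fun _ => eq_zero_of_energyForm_self hL₀.inverse)
      (b := fun σ => 1 / 2 * tensorInner C (actₗ L.inv σ) σ +
        1 / 2 * energyForm C L₀.inverse (projSperp C L₀ σ) (projSperp C L₀ σ))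
      (fun σ t => functionalP_add_smul_left hL₀ L εbar τ σ η t) g
  · rw [eE, add_sub_assoc]
    exact isGradientFor_iff (fun _ => eq_zero_of_energyForm_self hL₀)
      (b := fun κ => 1 / 2 * tensorInner C (actₗ L.toBddField κ) κ +
        1 / 2 * energyForm C L₀ (κ - projE₀ C L₀ κ) (κ - projE₀ C L₀ κ))
      (fun κ t => functionalP_add_smul_right hL₀ L εbar τ η κ t) g
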